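/- Let $n\ge 2$ and let $w\in\mathfrak S_n$ be fully supported, i.e. $\{w(1),\dots,w(r)\}\ne\{1,\dots,r\}$ for all $1\le r<n$. Let $u_1,\dots,u_n$ be unit vectors in the plane whose angles satisfy $\pi<\theta_1<\dots<\theta_n<2\pi$. Elnitsky's polygon $X(w)$ is the region enclosed by the two paths which start at a common top vertex and have successive edge vectors $u_1,\dots,u_n$ (the leftside boundary) and $u_{w(1)},\dots,u_{w(n)}$ (the rightside boundary); they end at a common bottom vertex, and a side parallel to $u_k$ is labeled $k$. A rhombic tiling of $X(w)$ is a finite set of rhombi (tiles) with pairwise disjoint interiors whose union is $X(w)$, each with its edges equal to translates of sides of $X(w)$ with two distinct labels; these are the labels of the tile. A forced bottom-perimeter tile for $w$ is a tile that belongs to every rhombic tiling of $X(w)$ and has as edges the two sides of $X(w)$ meeting at the bottom vertex. Then the following are equivalent: (a) there is a forced bottom-perimeter tile for $w$; (b) the values $w(n)$ and $n$ do not appear together in a $321$-pattern of $w$, i.e. there are no positions $i<j<k$ with $w(i)>w(j)>w(k)$ and $w(n),n\in\{w(i),w(j),w(k)\}$; (c) reading $w$ from right to left, the first right-to-left maximum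 after $w(n)$ is $n$, where $w(i)$ is a right-to-left maximum if $w(j)<w(i)$ for all $j>i$. Moreover, any forced bottom-perimeter tile for $w$ has labels $\{n,w(n)\}$. -/

import Mathlib

/-! Elnitsky polygons of permutations, their rhombic tilings, and forced bottom-perimeter tiles.
The plane is `ℂ`. Labels and positions are elements of `Fin n`, so that the label (or position) `k`
of the `1`-based convention is the element of `Fin n` with value `k - 1`. -/

namespace Elnitsky

/-- The angles of the side directions, travelling from the top vertex to the bottom vertex: strictly
increasing and in the open interval `(π, 2π)`, so that all sides point downwards and the path with
sides `1, …, n` turns counterclockwise by less than `π`, i.e. is half of a convex `2n`-gon. -/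
def IsDirectionSystem {n : ℕ} (θ : Fin n → ℝ) : Prop :=
  StrictMono θ ∧ ∀ k, θ k ∈ Set.Ioo Real.pi (2 * Real.pi)

/-- The unit vector along the sides labelled `k`. -/
noncomputable def dir {n : ℕ} (θ : Fin n → ℝ) (k : Fin n) : ℂ :=
  Complex.exp ((θ k : ℂ) * Complex.I)

/-- The vertex reached from the top vertex `0` after the first `k` sides of the path whose sides
are labelled `w(1), w(2), …, w(n)` from top to bottom. -/
noncomputable def pathVertex {n : ℕ} (θ : Fin n → ℝ) (w : Equiv.Perm (Fin n)) (k : ℕ) : ℂ :=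
  ∑ i : Fin n with i.val < k, dir θ (w i)

/-- The side in position `k` (labelled `w(k)`) of that path. -/
noncomputable def pathSide {n : ℕ} (θ : Fin n → ℝ) (w : Equiv.Perm (Fin n)) (k : Fin n) : Set ℂ :=
  segment ℝ (pathVertex θ w k.val) (pathVertex θ w (k.val + 1))

/-- The sides of the leftside boundary, labelled `1, …, n` from top to bottom. -/
noncomputable def leftSide {n : ℕ} (θ : Fin n → ℝ) (k : Fin n) : Set ℂ :=
  pathSide θ 1 k

/-- The sides of the rightside boundary, labelled `w(1), …, w(n)` from top to bottom. -/
noncomputable def rightSide {n : ℕ} (θ : Fin n → ℝ) (w : Equiv.Perm (Fin n)) (k : Fin n) : Set ℂ :=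
  pathSide θ w k

/-- Elnitsky's polygon `X(w)`, as a closed region. Both boundary paths descend strictly from the
common top vertex to the common bottom vertex, so the region that they enclose consists of
the points lying, on their horizontal line, between the leftside and the rightside boundary. -/
def polygon {n : ℕ} (θ : Fin n → ℝ) (w : Equiv.Perm (Fin n)) : Set ℂ :=
  {z | ∃ p ∈ ⋃ k, leftSide θ k, ∃ q ∈ ⋃ k, rightSide θ w k,
    p.im = z.im ∧ q.im = z.im ∧ p.re ≤ z.re ∧ z.re ≤ q.re}

/-- A rhombus whose sides are translates of the sides of the polygon with two distinct labels
`lo < hi`; it is determined by these labels and by its highest vertex `top`. -/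
structure Tile (n : ℕ) where
  top : ℂ
  lo : Fin n
  hi : Fin n
  lo_lt_hi : lo < hi

/-- The labels of a tile. -/
def Tile.labels {n : ℕ} (t : Tile n) : Finset (Fin n) := {t.lo, t.hi}

/-- The closed rhombus occupied by a tile. -/
def Tile.region {n : ℕ} (θ : Fin n → ℝ) (t : Tile n) : Set ℂ :=
  {z | ∃ a ∈ Set.Icc (0 : ℝ) 1, ∃ b ∈ Set.Icc (0 : ℝ) 1,
    z = t.top + (a : ℂ) * dir θ t.lo + (b : ℂ) * dir θ t.hi}

/-- The four edges of a tile: upper left, upper right, lower left, lower right. -/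
def Tile.edges {n : ℕ} (θ : Fin n → ℝ) (t : Tile n) : Set (Set ℂ) :=
  {segment ℝ t.top (t.top + dir θ t.lo),
   segment ℝ t.top (t.top + dir θ t.hi),
   segment ℝ (t.top + dir θ t.lo) (t.top + dir θ t.lo + dir θ t.hi),
   segment ℝ (t.top + dir θ t.hi) (t.top + dir θ t.lo + dir θ t.hi)}

/-- `T` is a rhombic tiling of `X(w)`: the tiles cover exactly the polygon, and distinct tiles have
disjoint interiors. -/
def IsRhombicTiling {n : ℕ} (θ : Fin n → ℝ) (w : Equiv.Perm (Fin n)) (T : Finset (Tile n)) : Prop :=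
  (⋃ t ∈ T, t.region θ) = polygon θ w ∧
    ∀ s ∈ T, ∀ t ∈ T, s ≠ t → Disjoint (interior (s.region θ)) (interior (t.region θ))

/-- The tile has among its edges both sides of the polygon that meet at the bottom vertex. -/
def IsBottomPerimeterTile {m : ℕ} (θ : Fin (m + 1) → ℝ) (w : Equiv.Perm (Fin (m + 1)))
    (t : Tile (m + 1)) : Prop :=
  leftSide θ (Fin.last m) ∈ t.edges θ ∧ rightSide θ w (Fin.last m) ∈ t.edges θ

/-- The tile `t` appears as a bottom-perimeter tile in every rhombic tiling of `X(w)`. -/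
def IsForcedBottomPerimeterTile {m : ℕ} (θ : Fin (m + 1) → ℝ) (w : Equiv.Perm (Fin (m + 1)))
    (t : Tile (m + 1)) : Prop :=
  ∀ T : Finset (Tile (m + 1)), IsRhombicTiling θ w T → t ∈ T ∧ IsBottomPerimeterTile θ w t

/-- `{w(1), …, w(r)} ≠ {1, …, r}` for all `1 ≤ r < n`. -/
def FullySupported {n : ℕ} (w : Equiv.Perm (Fin n)) : Prop :=
  ∀ r : ℕ, 1 ≤ r → r < n → w '' {i | i.val < r} ≠ {i | i.val < r}

/-- The values `a` and `b` appear together in some `321`-pattern of `w`. -/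
def TogetherIn321 {n : ℕ} (w : Equiv.Perm (Fin n)) (a b : Fin n) : Prop :=
  ∃ i j k : Fin n, i < j ∧ j < k ∧ w k < w j ∧ w j < w i ∧
    a ∈ ({w i, w j, w k} : Set (Fin n)) ∧ b ∈ ({w i, w j, w k} : Set (Fin n))

/-- The value in position `i` is a right-to-left maximum of `w`. -/
def IsRLMax {n : ℕ} (w : Equiv.Perm (Fin n)) (i : Fin n) : Prop :=
  ∀ j, i < j → w j < w i

/-- Reading `w` from right to left, the value `v` is the first right-to-left maximum met after
the value `w(n)`; that is, the position of `v` is the rightmost position before the last one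
that holds a right-to-left maximum. -/
def IsFirstRLMaxAfterLast {m : ℕ} (w : Equiv.Perm (Fin (m + 1))) (v : Fin (m + 1)) : Prop :=
  IsGreatest {i | i < Fin.last m ∧ IsRLMax w i} (w.symm v)

end Elnitsky

/-! A tile without its two left edges is a half-open rhombus, and a rhombic tiling amounts to a
partition of the polygon without its leftside boundary into such half-open tiles. This turns the
geometry into bookkeeping with adjacent transpositions: if `w(k) > w(k+1)`, exchanging the two sides
in positions `k, k+1` cuts off from `X(w)` exactly the half-open rhombus having these sides as right
edges. Every tiling with `w ≠ 1` contains such a rhombus: among the tiles whose upper right edge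
overlaps a side of the rightside boundary, a lowest one has two consecutive sides as right edges.
So the tilings are obtained from the degenerate polygon of the identity by adding such rhombi.

The first right-to-left maximum after `w(n)` is the rightmost entry `v > w(n)`. Moving it to the
right by adjacent transpositions until it stands next to `w(n)` yields a tiling containing the tile
at the bottom vertex with labels `w(n)` and `v`; no other bottom tile fits into that tiling, so a
forced bottom-perimeter tile requires `v = n`. Conversely, if `v = n`, removing a rhombus at the
right from any tiling preserves this condition unless the rhombus is the bottom tile itself. -/

namespace Elnitsky

open Set Filter Topology
open scoped Pointwise

section Directions

variable {n : ℕ} {θ : Fin n → ℝ} {i j : Fin n}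

/-- The signed area of the parallelogram spanned by two plane vectors; it is positive when the
second vector points to the left of the first one. -/
def cross (u v : ℂ) : ℝ := u.re * v.im - u.im * v.re

lemma cross_swap (u v : ℂ) : cross v u = -cross u v := by
  unfold cross; ring

lemma cross_self (u : ℂ) : cross u u = 0 := by
  unfold cross; ring

lemma cross_sum {ι : Type*} (s : Finset ι) (u : ℂ) (c : ι → ℝ) (v : ι → ℂ) :
    cross u (∑ i ∈ s, (c i : ℂ) * v i) = ∑ i ∈ s, c i * cross u (v i) := by
  simp only [cross, Complex.re_sum, Complex.im_sum, Complex.re_ofReal_mul, Complex.im_ofReal_mul,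
    Finset.mul_sum, ← Finset.sum_sub_distrib]
  exact Finset.sum_congr rfl fun i _ => by ring

lemma cross_mul_eq (u v z : ℂ) :
    (cross u v : ℂ) * z = (cross z v : ℂ) * u + (cross u z : ℂ) * v := by
  apply Complex.ext <;>
    simp only [cross, Complex.add_re, Complex.add_im, Complex.re_ofReal_mul,
      Complex.im_ofReal_mul] <;>
    ring

lemma dir_re (k : Fin n) : (dir θ k).re = Real.cos (θ k) := Complex.exp_ofReal_mul_I_re _

lemma dir_im (k : Fin n) : (dir θ k).im = Real.sin (θ k) := Complex.exp_ofReal_mul_I_im _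

lemma IsDirectionSystem.dir_im_neg (hθ : IsDirectionSystem θ) (k : Fin n) : (dir θ k).im < 0 := by
  rw [dir_im, ← Real.sin_sub_two_pi]
  exact Real.sin_neg_of_neg_of_neg_pi_lt (by linarith [(hθ.2 k).2]) (by linarith [(hθ.2 k).1])

lemma IsDirectionSystem.dir_ne_zero (hθ : IsDirectionSystem θ) (k : Fin n) : dir θ k ≠ 0 :=
  fun h => (hθ.dir_im_neg k).ne (by simp [h])

lemma IsDirectionSystem.cross_dir_pos (hθ : IsDirectionSystem θ) (h : i < j) :
    0 < cross (dir θ i) (dir θ j) := by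
  have e : cross (dir θ i) (dir θ j) = Real.sin (θ j - θ i) := by
    rw [cross, dir_re, dir_re, dir_im, dir_im, Real.sin_sub]; ring
  rw [e]
  exact Real.sin_pos_of_pos_of_lt_pi (by linarith [hθ.1 h])
    (by linarith [(hθ.2 i).1, (hθ.2 j).2])

lemma IsDirectionSystem.cross_dir_ne_zero (hθ : IsDirectionSystem θ) (h : i ≠ j) :
    cross (dir θ i) (dir θ j) ≠ 0 := by
  rcases h.lt_or_gt with h | h
  · exact (hθ.cross_dir_pos h).ne'
  · rw [cross_swap, neg_ne_zero]
    exact (hθ.cross_dir_pos h).ne'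

lemma IsDirectionSystem.eq_of_mul_dir_eq (hθ : IsDirectionSystem θ) {a b : ℝ} (ha : a ≠ 0)
    (e : (a : ℂ) * dir θ i = (b : ℂ) * dir θ j) : i = j := by
  by_contra h
  have hre : a * (dir θ i).re = b * (dir θ j).re := by simpa using congrArg Complex.re e
  have him : a * (dir θ i).im = b * (dir θ j).im := by simpa using congrArg Complex.im e
  have : a * cross (dir θ i) (dir θ j) = 0 := by
    unfold cross
    linear_combination (dir θ j).im * hre - (dir θ j).re * him
  exact (mul_ne_zero ha (hθ.cross_dir_ne_zero h)) this

lemma IsDirectionSystem.dir_injective (hθ : IsDirectionSystem θ) : Function.Injective (dir θ) :=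
  fun i j h => hθ.eq_of_mul_dir_eq (a := 1) (b := 1) one_ne_zero (by rw [h])

lemma IsDirectionSystem.exists_one_eq (hθ : IsDirectionSystem θ) (h : i < j) :
    ∃ α > (0 : ℝ), ∃ β > (0 : ℝ), (1 : ℂ) = α * dir θ j - β * dir θ i := by
  have hD := hθ.cross_dir_pos h
  refine ⟨-(dir θ i).im / cross (dir θ i) (dir θ j), div_pos (neg_pos.2 (hθ.dir_im_neg i)) hD,
    -(dir θ j).im / cross (dir θ i) (dir θ j), div_pos (neg_pos.2 (hθ.dir_im_neg j)) hD, ?_⟩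
  have hD' : (cross (dir θ i) (dir θ j) : ℂ) ≠ 0 := by exact_mod_cast hD.ne'
  have e := cross_mul_eq (dir θ i) (dir θ j) 1
  simp only [cross, Complex.one_re, Complex.one_im, one_mul, zero_mul, mul_zero, mul_one, sub_zero,
    zero_sub] at e
  rw [← mul_right_inj' hD']
  push_cast [cross] at e hD' ⊢
  field_simp
  linear_combination e

lemma IsDirectionSystem.nonneg_of_sum_eq (hθ : IsDirectionSystem θ) {d : Fin n → ℝ} {r : ℝ}
    (hlt : ∀ i < j, d i ≤ 0) (hgt : ∀ i > j, 0 ≤ d i) (e : ∑ i, (d i : ℂ) * dir θ i = r) :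
    0 ≤ r ∧ (r = 0 → d = 0) := by
  have hj := hθ.dir_im_neg j
  -- Taking the cross product with `dir θ j` makes all terms of the sum nonnegative.
  have key : ∑ i, d i * cross (dir θ j) (dir θ i) = -(dir θ j).im * r := by
    rw [← cross_sum, e]; simp [cross]
  have hterm : ∀ i ∈ Finset.univ, 0 ≤ d i * cross (dir θ j) (dir θ i) := fun i _ => by
    rcases lt_trichotomy i j with h | rfl | h
    · rw [cross_swap]
      exact mul_nonneg_of_nonpos_of_nonpos (hlt i h) (neg_nonpos.2 (hθ.cross_dir_pos h).le)
    · rw [cross_self, mul_zero]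
    · exact mul_nonneg (hgt i h) (hθ.cross_dir_pos h).le
  constructor
  · exact nonneg_of_mul_nonneg_right (key ▸ Finset.sum_nonneg hterm) (neg_pos.2 hj)
  · rintro rfl
    rw [mul_zero, Finset.sum_eq_zero_iff_of_nonneg hterm] at key
    have hne : ∀ i, i ≠ j → d i = 0 := fun i h =>
      (mul_eq_zero.1 (key i (Finset.mem_univ i))).resolve_right (hθ.cross_dir_ne_zero h.symm)
    have hjj : d j = 0 := by
      rw [Finset.sum_eq_single j (fun i _ h => by rw [hne i h]; simp) (by simp)] at e
      simpa [hθ.dir_ne_zero j] using e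
    funext i
    rcases eq_or_ne i j with rfl | h
    · exact hjj
    · exact hne i h

end Directions

section Shadows

variable {S T : Set ℂ}

/-- The points lying horizontally to the right of some point of `S`. -/
def rightOf (S : Set ℂ) : Set ℂ := {z | ∃ r : ℝ, r ≤ 0 ∧ z + r ∈ S}

/-- The points lying horizontally to the left of some point of `S`. -/
def leftOf (S : Set ℂ) : Set ℂ := {z | ∃ r : ℝ, 0 ≤ r ∧ z + r ∈ S}

lemma tendsto_add_ofReal_nhdsWithin (z : ℂ) (R : Set ℝ) :
    Tendsto (fun ε : ℝ => z + ε) (𝓝[R] 0) (𝓝 z) := by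
  have h : Continuous fun ε : ℝ => z + ε := by fun_prop
  simpa using (h.tendsto 0).mono_left nhdsWithin_le_nhds

lemma mem_of_add_mem_of_convex {z : ℂ} {a b : ℝ} (hS : Convex ℝ S) (ha : a ≤ 0) (hb : 0 ≤ b)
    (hza : z + a ∈ S) (hzb : z + b ∈ S) : z ∈ S := by
  have : Convex ℝ {r : ℝ | z + r ∈ S} :=
    (hS.translate_preimage_right z).linear_preimage Complex.ofRealCLM.toLinearMap
  simpa using this.ordConnected.out hza hzb ⟨ha, hb⟩

lemma subset_rightOf : S ⊆ rightOf S := fun z hz => ⟨0, le_rfl, by simpa using hz⟩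

lemma subset_leftOf : S ⊆ leftOf S := fun z hz => ⟨0, le_rfl, by simpa using hz⟩

lemma rightOf_subset_rightOf (h : S ⊆ rightOf T) : rightOf S ⊆ rightOf T := by
  rintro z ⟨r, hr, hz⟩
  obtain ⟨s, hs, hz'⟩ := h hz
  exact ⟨r + s, by linarith, by simpa [add_assoc] using hz'⟩

lemma leftOf_subset_leftOf (h : S ⊆ leftOf T) : leftOf S ⊆ leftOf T := by
  rintro z ⟨r, hr, hz⟩
  obtain ⟨s, hs, hz'⟩ := h hz
  exact ⟨r + s, by linarith, by simpa [add_assoc] using hz'⟩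

lemma isClosed_setOf_exists_add_mem (hS : IsCompact S) {R : Set ℝ} (hR : IsClosed R) :
    IsClosed {z : ℂ | ∃ r : ℝ, r ∈ R ∧ z + r ∈ S} := by
  have e : {z : ℂ | ∃ r : ℝ, r ∈ R ∧ z + r ∈ S} = S + -(Complex.ofReal '' R) := by
    ext z
    constructor
    · rintro ⟨r, hr, hz⟩
      exact ⟨_, hz, -r, by simpa using hr, by simp⟩
    · rintro ⟨p, hp, q, ⟨r, hr, hq⟩, rfl⟩
      exact ⟨r, hr, by simpa [hq] using hp⟩
  rw [e]
  exact IsClosed.add_left_of_isCompact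
    (Complex.isometry_ofReal.isClosedEmbedding.isClosedMap R hR).neg hS

lemma isClosed_rightOf (hS : IsCompact S) : IsClosed (rightOf S) :=
  isClosed_setOf_exists_add_mem hS isClosed_Iic

lemma isClosed_leftOf (hS : IsCompact S) : IsClosed (leftOf S) :=
  isClosed_setOf_exists_add_mem hS isClosed_Ici

end Shadows

section Paths

variable {n : ℕ} {θ : Fin n → ℝ} {w : Equiv.Perm (Fin n)} {z : ℂ} {r s σ τ : ℝ}

/-- How much of the side in position `i` lies above the point at arc length `τ` of a path. -/
noncomputable def ramp (τ : ℝ) (i : ℕ) : ℝ := max 0 (min 1 (τ - i))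

lemma ramp_nonneg (τ : ℝ) (i : ℕ) : 0 ≤ ramp τ i := le_max_left _ _

lemma ramp_le_one (τ : ℝ) (i : ℕ) : ramp τ i ≤ 1 := max_le zero_le_one (min_le_left _ _)

lemma ramp_mono (i : ℕ) : Monotone fun τ => ramp τ i := fun _ _ h =>
  max_le_max le_rfl (min_le_min le_rfl (by linarith))

lemma ramp_pos_iff {i : ℕ} : 0 < ramp τ i ↔ i < τ := by simp [ramp]

lemma ramp_eq_one_iff {i : ℕ} : ramp τ i = 1 ↔ i + 1 ≤ τ := by
  rw [← (ramp_le_one τ i).ge_iff_eq, ramp, le_max_iff, le_min_iff]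
  constructor
  · rintro (h | h) <;> linarith [h]
  · exact fun h => Or.inr ⟨le_rfl, by linarith⟩

lemma ramp_add (k i : ℕ) (hs : s ∈ Icc (0 : ℝ) 1) :
    ramp (k + s) i = if i < k then 1 else if i = k then s else 0 := by
  split_ifs with h h'
  · have : (i : ℝ) + 1 ≤ k := by exact_mod_cast h
    exact ramp_eq_one_iff.2 (by linarith [hs.1])
  · rw [ramp, h', add_sub_cancel_left, min_eq_right hs.2, max_eq_right hs.1]
  · have : (k : ℝ) + 1 ≤ i := by exact_mod_cast (not_lt.1 h).lt_of_ne' h'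
    exact ((ramp_nonneg _ i).eq_of_not_lt fun hlt => by linarith [ramp_pos_iff.1 hlt, hs.2]).symm

lemma sum_ramp (hτ : τ ∈ Icc (0 : ℝ) n) : ∑ i : Fin n, ramp τ i = τ := by
  have telescope (i : ℕ) : ramp τ i = min τ ((i + 1 : ℕ) : ℝ) - min τ i := by
    push_cast
    rcases le_total τ i with h | h <;> rcases le_total τ (i + 1) with h' | h' <;>
      simp [ramp, h, h'] <;> linarith
  rw [Fin.sum_univ_eq_sum_range (ramp τ), Finset.sum_congr rfl fun i _ => telescope i,
    Finset.sum_range_sub (fun i : ℕ => min τ (i : ℝ))]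
  simp [hτ.1, hτ.2]

lemma exists_eq_fin_add [NeZero n] (h : τ ∈ Icc (0 : ℝ) n) :
    ∃ k : Fin n, ∃ s ∈ Icc (0 : ℝ) 1, τ = (k : ℕ) + s := by
  rcases h.2.eq_or_lt with rfl | e
  · have : ((n - 1 : ℕ) : ℝ) + 1 = n := by exact_mod_cast Nat.sub_add_cancel (NeZero.pos n)
    exact ⟨⟨n - 1, Nat.sub_lt (NeZero.pos n) one_pos⟩, 1, ⟨zero_le_one, le_rfl⟩, this.symm⟩
  · exact ⟨⟨⌊τ⌋₊, (Nat.floor_lt h.1).2 e⟩, τ - ⌊τ⌋₊,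
      ⟨by linarith [Nat.floor_le h.1], by linarith [Nat.lt_floor_add_one τ]⟩, by simp⟩

lemma fin_add_mem_Icc (k : Fin n) (hs : s ∈ Icc (0 : ℝ) 1) : (k : ℕ) + s ∈ Icc (0 : ℝ) n := by
  have hk : ((k : ℕ) : ℝ) + 1 ≤ n := by exact_mod_cast k.2
  exact ⟨add_nonneg (Nat.cast_nonneg _) hs.1, by linarith [hs.2]⟩

/-- The boundary path whose sides are labelled `w(1), …, w(n)` from top to bottom. -/
def path (θ : Fin n → ℝ) (w : Equiv.Perm (Fin n)) : Set ℂ := ⋃ k, pathSide θ w k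

/-- The point at arc length `τ` of a path. -/
noncomputable def pathPoint (θ : Fin n → ℝ) (w : Equiv.Perm (Fin n)) (τ : ℝ) : ℂ :=
  ∑ i : Fin n, (ramp τ i : ℂ) * dir θ (w i)

lemma pathVertex_succ (w : Equiv.Perm (Fin n)) (k : Fin n) :
    pathVertex θ w ((k : ℕ) + 1) = pathVertex θ w k + dir θ (w k) := by
  have e : (Finset.univ.filter fun i : Fin n => i.val < (k : ℕ) + 1) =
      insert k (Finset.univ.filter fun i : Fin n => i.val < (k : ℕ)) := by
    ext i
    simp only [Finset.mem_filter, Finset.mem_univ, true_and, Finset.mem_insert, Fin.ext_iff]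
    omega
  rw [pathVertex, e, Finset.sum_insert (by simp), add_comm, pathVertex]

lemma pathVertex_card (w : Equiv.Perm (Fin n)) : pathVertex θ w n = ∑ i, dir θ i := by
  simp only [pathVertex, Fin.is_lt, Finset.filter_true]
  exact Equiv.sum_comp w (dir θ)

lemma pathPoint_add (w : Equiv.Perm (Fin n)) (k : Fin n) (hs : s ∈ Icc (0 : ℝ) 1) :
    pathPoint θ w ((k : ℕ) + s) = pathVertex θ w k + (s : ℂ) * dir θ (w k) := by
  rw [pathPoint, pathVertex, Finset.sum_filter,
    ← Fintype.sum_ite_eq' k fun i => (s : ℂ) * dir θ (w i), ← Finset.sum_add_distrib]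
  refine Finset.sum_congr rfl fun i _ => ?_
  rw [ramp_add _ _ hs]
  rcases lt_trichotomy (i : ℕ) k with h | h | h
  · simp [h, Fin.ne_of_lt h]
  · simp [Fin.ext h]
  · simp [h.not_gt, h.ne', Fin.ne_of_gt h]

lemma mem_pathSide_iff {k : Fin n} :
    z ∈ pathSide θ w k ↔ ∃ s ∈ Icc (0 : ℝ) 1, z = pathVertex θ w k + (s : ℂ) * dir θ (w k) := by
  rw [pathSide, pathVertex_succ, segment_eq_image']
  simp only [mem_image, add_sub_cancel_left, Complex.real_smul, eq_comm]

lemma pathSide_subset_path (w : Equiv.Perm (Fin n)) (k : Fin n) : pathSide θ w k ⊆ path θ w :=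
  subset_iUnion _ k

lemma exists_pathPoint_eq (h : z ∈ path θ w) : ∃ τ ∈ Icc (0 : ℝ) n, pathPoint θ w τ = z := by
  obtain ⟨k, hk⟩ := mem_iUnion.1 h
  obtain ⟨s, hs, rfl⟩ := mem_pathSide_iff.1 hk
  exact ⟨_, fin_add_mem_Icc k hs, pathPoint_add w k hs⟩

lemma pathPoint_mem_path [NeZero n] (w : Equiv.Perm (Fin n)) (hτ : τ ∈ Icc (0 : ℝ) n) :
    pathPoint θ w τ ∈ path θ w := by
  obtain ⟨k, s, hs, rfl⟩ := exists_eq_fin_add hτ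
  exact pathSide_subset_path w k (mem_pathSide_iff.2 ⟨s, hs, pathPoint_add w k hs⟩)

lemma neZero_of_mem_path (h : z ∈ path θ w) : NeZero n :=
  let ⟨k, _⟩ := mem_iUnion.1 h
  NeZero.of_pos k.pos

lemma continuous_pathPoint (w : Equiv.Perm (Fin n)) : Continuous (pathPoint θ w) := by
  unfold pathPoint ramp
  fun_prop

lemma isCompact_path (w : Equiv.Perm (Fin n)) : IsCompact (path θ w) :=
  isCompact_iUnion fun k => by
    rw [pathSide, segment_eq_image']
    exact isCompact_Icc.image (by fun_prop)

lemma pathPoint_zero (w : Equiv.Perm (Fin n)) : pathPoint θ w 0 = 0 := by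
  have (i : ℕ) : ramp 0 i = 0 :=
    ((ramp_nonneg _ i).eq_of_not_lt fun h => (ramp_pos_iff.1 h).not_ge i.cast_nonneg).symm
  simp [pathPoint, this]

lemma pathPoint_card (w : Equiv.Perm (Fin n)) : pathPoint θ w n = ∑ i, dir θ i := by
  have (i : Fin n) : ramp n i = 1 := ramp_eq_one_iff.2 (by exact_mod_cast i.is_lt)
  simp only [pathPoint, this, Complex.ofReal_one, one_mul]
  exact Equiv.sum_comp w (dir θ)

lemma pathPoint_eq_sum_symm (w : Equiv.Perm (Fin n)) (τ : ℝ) :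
    pathPoint θ w τ = ∑ i, (ramp τ (w.symm i) : ℂ) * dir θ i := by
  rw [pathPoint, ← Equiv.sum_comp w fun i => (ramp τ (w.symm i) : ℂ) * dir θ i]
  simp

namespace IsDirectionSystem

lemma strictAntiOn_im_pathPoint (hθ : IsDirectionSystem θ) (w : Equiv.Perm (Fin n)) :
    StrictAntiOn (fun τ => (pathPoint θ w τ).im) (Icc 0 n) := fun τ hτ σ hσ h => by
  simp only [pathPoint, Complex.im_sum, Complex.im_ofReal_mul]
  obtain ⟨i, hi, hlt⟩ := Finset.exists_lt_of_sum_lt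
    (show ∑ i : Fin n, ramp τ i < ∑ i : Fin n, ramp σ i by rwa [sum_ramp hτ, sum_ramp hσ])
  exact Finset.sum_lt_sum (fun i _ => mul_le_mul_of_nonpos_right (ramp_mono i h.le)
    (hθ.dir_im_neg _).le) ⟨i, hi, mul_lt_mul_of_neg_right hlt (hθ.dir_im_neg _)⟩

lemma eq_of_add_mem_path (hθ : IsDirectionSystem θ) (hr : z + r ∈ path θ w)
    (hs : z + s ∈ path θ w) : r = s := by
  obtain ⟨τ, hτ, e⟩ := exists_pathPoint_eq hr
  obtain ⟨σ, hσ, e'⟩ := exists_pathPoint_eq hs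
  have : τ = σ := (hθ.strictAntiOn_im_pathPoint w).injOn hτ hσ (by simp [e, e'])
  subst this
  simpa using e.symm.trans e'

lemma exists_add_mem_path (hθ : IsDirectionSystem θ) (h : z ∈ path θ w)
    (w' : Equiv.Perm (Fin n)) : ∃ r : ℝ, z + r ∈ path θ w' := by
  have := neZero_of_mem_path h
  obtain ⟨τ, hτ, rfl⟩ := exists_pathPoint_eq h
  have anti := (hθ.strictAntiOn_im_pathPoint w).antitoneOn
  have h0 : (0 : ℝ) ∈ Icc (0 : ℝ) n := left_mem_Icc.2 n.cast_nonneg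
  have h1 : (n : ℝ) ∈ Icc (0 : ℝ) n := right_mem_Icc.2 n.cast_nonneg
  obtain ⟨σ, hσ, e⟩ := intermediate_value_Icc' n.cast_nonneg
    (Complex.continuous_im.comp (continuous_pathPoint (θ := θ) w')).continuousOn
    (show (pathPoint θ w τ).im ∈ _ from
      ⟨by simpa [pathPoint_card] using anti hτ h1 hτ.2,
        by simpa [pathPoint_zero] using anti h0 hτ hτ.1⟩)
  refine ⟨(pathPoint θ w' σ).re - (pathPoint θ w τ).re, ?_⟩
  convert pathPoint_mem_path (θ := θ) w' hσ using 1
  apply Complex.ext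
  · simp
  · simpa using e.symm

lemma nonpos_of_pathPoint_add_eq (hθ : IsDirectionSystem θ) (hσ : σ ∈ Icc (0 : ℝ) n)
    (e : pathPoint θ w τ + r = pathPoint θ 1 σ) :
    r ≤ 0 ∧ (r = 0 → ∀ i : Fin n, ramp τ (w.symm i) = ramp σ i) := by
  rcases n.eq_zero_or_pos with rfl | hn
  · have : r = 0 := by simpa [pathPoint] using e
    exact ⟨this.le, fun _ i => i.elim0⟩
  have := NeZero.of_pos hn
  obtain ⟨j, s, hs, rfl⟩ := exists_eq_fin_add hσ
  have := hθ.nonneg_of_sum_eq (j := j) (d := fun i => ramp τ (w.symm i) - ramp (j + s) i)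
    (r := -r) (fun i hi => ?_) (fun i hi => ?_) ?_
  · exact ⟨neg_nonneg.1 this.1, fun hr i => sub_eq_zero.1 (congrFun (this.2 (by simp [hr])) i)⟩
  · rw [ramp_add _ _ hs, if_pos (by exact hi)]
    linarith [ramp_le_one τ (w.symm i)]
  · have hij : ¬ (i : ℕ) < j ∧ (i : ℕ) ≠ j := ⟨Fin.not_lt.2 hi.le, (Fin.val_ne_of_ne hi.ne')⟩
    rw [ramp_add _ _ hs, if_neg hij.1, if_neg hij.2, sub_zero]
    exact ramp_nonneg _ _
  · push_cast
    simp only [sub_mul, Finset.sum_sub_distrib]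
    rw [← pathPoint_eq_sum_symm, eq_sub_of_add_eq e, pathPoint]
    simp

lemma eq_of_pathPoint_eq (hθ : IsDirectionSystem θ) (hτ : τ ∈ Icc (0 : ℝ) n)
    (hσ : σ ∈ Icc (0 : ℝ) n) (e : pathPoint θ w τ = pathPoint θ 1 σ) :
    τ = σ ∧ ∀ i : Fin n, ramp τ i = ramp τ (w i) := by
  have key := (hθ.nonpos_of_pathPoint_add_eq (r := 0) hσ (by simpa using e)).2 rfl
  have : τ = σ := by
    rw [← sum_ramp hτ, ← sum_ramp hσ, ← Equiv.sum_comp w.symm]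
    exact Finset.sum_congr rfl fun i _ => key i
  subst this
  exact ⟨rfl, fun i => by simpa using key (w i)⟩

lemma path_subset_rightOf (hθ : IsDirectionSystem θ) (w : Equiv.Perm (Fin n)) :
    path θ w ⊆ rightOf (path θ 1) := fun z hz => by
  obtain ⟨r, hr⟩ := hθ.exists_add_mem_path hz 1
  refine ⟨r, ?_, hr⟩
  obtain ⟨τ, -, rfl⟩ := exists_pathPoint_eq hz
  obtain ⟨σ, hσ, e⟩ := exists_pathPoint_eq hr
  exact (hθ.nonpos_of_pathPoint_add_eq hσ e.symm).1

lemma notMem_leftOf_path (hθ : IsDirectionSystem θ) (hr : r < 0)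
    (h : z + r ∈ rightOf (path θ w)) : z ∉ leftOf (path θ w) := by
  rintro ⟨s, hs, hz⟩
  obtain ⟨r', hr', hz'⟩ := h
  have : s = r + r' := hθ.eq_of_add_mem_path hz (by simpa [add_assoc] using hz')
  linarith

lemma path_one_subset_leftOf (hθ : IsDirectionSystem θ) (w : Equiv.Perm (Fin n)) :
    path θ 1 ⊆ leftOf (path θ w) := fun z hz => by
  obtain ⟨r, hr⟩ := hθ.exists_add_mem_path hz w
  refine ⟨r, le_of_not_gt fun hneg => ?_, hr⟩
  exact hθ.notMem_leftOf_path hneg (hθ.path_subset_rightOf w hr) (subset_leftOf hz)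

end IsDirectionSystem

lemma polygon_eq_inter (θ : Fin n → ℝ) (w : Equiv.Perm (Fin n)) :
    polygon θ w = rightOf (path θ 1) ∩ leftOf (path θ w) := by
  ext z
  constructor
  · rintro ⟨p, hp, q, hq, hp', hq', hle, hle'⟩
    have ep : z + ((p.re - z.re : ℝ) : ℂ) = p := by apply Complex.ext <;> simp [hp']
    have eq : z + ((q.re - z.re : ℝ) : ℂ) = q := by apply Complex.ext <;> simp [hq']
    exact ⟨⟨p.re - z.re, by linarith, by rwa [ep]⟩, q.re - z.re, by linarith, by rwa [eq]⟩
  · rintro ⟨⟨r, hr, hp⟩, s, hs, hq⟩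
    exact ⟨_, hp, _, hq, by simp, by simp, by simpa using hr, by simpa using hs⟩

lemma isClosed_polygon (θ : Fin n → ℝ) (w : Equiv.Perm (Fin n)) : IsClosed (polygon θ w) := by
  rw [polygon_eq_inter]
  exact (isClosed_rightOf (isCompact_path 1)).inter (isClosed_leftOf (isCompact_path w))

namespace IsDirectionSystem

lemma path_subset_polygon (hθ : IsDirectionSystem θ) (w : Equiv.Perm (Fin n)) :
    path θ w ⊆ polygon θ w := by
  rw [polygon_eq_inter]
  exact subset_inter (hθ.path_subset_rightOf w) subset_leftOf

lemma polygon_one (hθ : IsDirectionSystem θ) : polygon θ 1 = path θ 1 := by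
  refine Subset.antisymm (fun z hz => ?_) (hθ.path_subset_polygon 1)
  rw [polygon_eq_inter] at hz
  obtain ⟨⟨r, hr, hz'⟩, hz⟩ := hz
  rcases hr.eq_or_lt with rfl | hr
  · simpa using hz'
  · exact absurd hz (hθ.notMem_leftOf_path hr (subset_rightOf hz'))

end IsDirectionSystem

lemma FullySupported.pathPoint_ne (hθ : IsDirectionSystem θ) (hw : FullySupported w) (hn : 2 ≤ n)
    (hτ : τ ∈ Ioo (0 : ℝ) n) (hσ : σ ∈ Icc (0 : ℝ) n) : pathPoint θ w τ ≠ pathPoint θ 1 σ :=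
  fun e => by
  have key := (hθ.eq_of_pathPoint_eq (Ioo_subset_Icc_self hτ) hσ e).2
  have image_eq (r : ℕ) (P : ℝ → Prop) (h : ∀ i : Fin n, i.val < r ↔ P (ramp τ i)) :
      w '' {i | i.val < r} = {i | i.val < r} := by
    rw [Equiv.image_eq_preimage_symm]
    ext i
    simp only [mem_preimage, mem_ofPred_eq, h, key (w.symm i), Equiv.apply_symm_apply]
  rcases lt_or_ge τ 1 with h1 | h1
  · refine hw 1 le_rfl hn (image_eq 1 (0 < ·) fun i => ?_)
    rw [ramp_pos_iff, Nat.lt_one_iff]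
    refine ⟨fun h => by simpa [h] using hτ.1, fun h => ?_⟩
    exact Nat.lt_one_iff.1 (by exact_mod_cast h.trans h1)
  · refine hw ⌊τ⌋₊ ((Nat.one_le_floor_iff τ).2 h1) ((Nat.floor_lt hτ.1.le).2 hτ.2)
      (image_eq _ (· = 1) fun i => ?_)
    rw [ramp_eq_one_iff, ← Nat.succ_le_iff, Nat.le_floor_iff hτ.1.le]
    push_cast
    rfl

lemma FullySupported.closure_polygon_sdiff (hθ : IsDirectionSystem θ) (hw : FullySupported w)
    (hn : 2 ≤ n) : closure (polygon θ w \ path θ 1) = polygon θ w := by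
  refine (closure_minimal sdiff_subset (isClosed_polygon θ w)).antisymm fun z hz => ?_
  by_cases hz1 : z ∈ path θ 1
  swap
  · exact subset_closure ⟨hz, hz1⟩
  have interior_mem : MapsTo (pathPoint θ 1) (Ioo 0 n) (closure (polygon θ w \ path θ 1)) :=
    fun τ hτ => by
    have := NeZero.of_pos (two_pos.trans_le hn)
    have hp := pathPoint_mem_path (θ := θ) 1 (Ioo_subset_Icc_self hτ)
    obtain ⟨r, hr, hr'⟩ := hθ.path_one_subset_leftOf w hp
    have hr0 : r ≠ 0 := by
      rintro rfl
      obtain ⟨τ', hτ', e⟩ := exists_pathPoint_eq hr'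
      rw [Complex.ofReal_zero, add_zero] at e
      obtain rfl := (hθ.eq_of_pathPoint_eq hτ' (Ioo_subset_Icc_self hτ) e).1
      exact hw.pathPoint_ne hθ hn hτ hτ' e
    refine mem_closure_of_tendsto (tendsto_add_ofReal_nhdsWithin _ (Ioi 0)) ?_
    filter_upwards [Ioo_mem_nhdsGT (hr.lt_of_ne' hr0)] with ε hε
    rw [polygon_eq_inter]
    refine ⟨⟨⟨-ε, by linarith [hε.1], by simpa using hp⟩, r - ε, by linarith [hε.2], ?_⟩,
      fun h => hε.1.ne ?_⟩
    · simpa using hr'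
    · exact hθ.eq_of_add_mem_path (r := 0) (by simpa using hp) h
  obtain ⟨τ, hτ, rfl⟩ := exists_pathPoint_eq hz1
  rw [← closure_Ioo (Nat.cast_ne_zero.2 (by omega)).symm] at hτ
  exact closure_closure.subset (map_mem_closure (continuous_pathPoint 1) hτ interior_mem)

end Paths

section Tiles

variable {n : ℕ} {θ : Fin n → ℝ} {z : ℂ}

lemma exists_slide {x y p q : ℝ} (hx : 0 ≤ x) (hy : 0 ≤ y) (hp : 0 < p) (hq : 0 < q) :
    ∃ ε ≥ 0, 0 ≤ x - ε * p ∧ 0 ≤ y - ε * q ∧ (x - ε * p = 0 ∨ y - ε * q = 0) := by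
  rcases le_total (x / p) (y / q) with h | h
  · have hxp : x / p * p = x := div_mul_cancel₀ x hp.ne'
    exact ⟨x / p, by positivity, by simp [hxp], by linarith [(le_div_iff₀ hq).1 h],
      Or.inl (by simp [hxp])⟩
  · have hyq : y / q * q = y := div_mul_cancel₀ y hq.ne'
    exact ⟨y / q, by positivity, by linarith [(le_div_iff₀ hp).1 h], by simp [hyq],
      Or.inr (by simp [hyq])⟩

namespace Tile

variable {t : Tile n} {x : ℝ × ℝ}

/-- The point of the plane with given coordinates in the frame of a tile, whose origin is the
highest vertex and whose axes are the edge vectors labelled `lo` and `hi`. -/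
noncomputable def point (θ : Fin n → ℝ) (t : Tile n) (x : ℝ × ℝ) : ℂ :=
  t.top + (x.1 : ℂ) * dir θ t.lo + (x.2 : ℂ) * dir θ t.hi

/-- A tile without its two left edges: the points of the tile that have points of the tile
immediately to their left. -/
noncomputable def halfOpen (θ : Fin n → ℝ) (t : Tile n) : Set ℂ :=
  t.point θ '' (Ico 0 1 ×ˢ Ioc 0 1)

/-- The union of the two left edges of a tile. -/
noncomputable def leftBoundary (θ : Fin n → ℝ) (t : Tile n) : Set ℂ :=
  t.point θ '' {x ∈ Icc 0 1 ×ˢ Icc 0 1 | x.1 = 1 ∨ x.2 = 0}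

/-- The union of the two right edges of a tile. -/
noncomputable def rightBoundary (θ : Fin n → ℝ) (t : Tile n) : Set ℂ :=
  t.point θ '' {x ∈ Icc 0 1 ×ˢ Icc 0 1 | x.1 = 0 ∨ x.2 = 1}

/-- The frame of a tile, as a global coordinate system of the plane. -/
noncomputable def chart (hθ : IsDirectionSystem θ) (t : Tile n) : ℝ × ℝ ≃ₜ ℂ where
  toFun := t.point θ
  invFun z := (cross (z - t.top) (dir θ t.hi) / cross (dir θ t.lo) (dir θ t.hi),
    cross (dir θ t.lo) (z - t.top) / cross (dir θ t.lo) (dir θ t.hi))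
  left_inv x := by
    have hD := (hθ.cross_dir_pos t.lo_lt_hi).ne'
    ext <;> rw [div_eq_iff hD] <;>
      simp only [cross, point, Complex.sub_re, Complex.sub_im, Complex.add_re, Complex.add_im,
        Complex.re_ofReal_mul, Complex.im_ofReal_mul] <;>
      ring
  right_inv z := by
    have hD : (cross (dir θ t.lo) (dir θ t.hi) : ℂ) ≠ 0 := by
      exact_mod_cast (hθ.cross_dir_pos t.lo_lt_hi).ne'
    have e := cross_mul_eq (dir θ t.lo) (dir θ t.hi) (z - t.top)
    unfold point
    push_cast
    field_simp
    linear_combination -e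
  continuous_toFun := by unfold point; fun_prop
  continuous_invFun := by unfold cross; fun_prop

lemma coe_chart (hθ : IsDirectionSystem θ) (t : Tile n) : ⇑(t.chart hθ) = t.point θ := rfl

lemma point_injective (hθ : IsDirectionSystem θ) (t : Tile n) : Function.Injective (t.point θ) :=
  (t.chart hθ).injective

lemma point_surjective (hθ : IsDirectionSystem θ) (t : Tile n) :
    Function.Surjective (t.point θ) :=
  (t.chart hθ).surjective

lemma region_eq_image (t : Tile n) : t.region θ = t.point θ '' (Icc 0 1 ×ˢ Icc 0 1) := by
  ext z
  constructor
  · rintro ⟨a, ha, b, hb, rfl⟩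
    exact ⟨(a, b), ⟨ha, hb⟩, rfl⟩
  · rintro ⟨x, hx, rfl⟩
    exact ⟨x.1, hx.1, x.2, hx.2, rfl⟩

lemma interior_region (hθ : IsDirectionSystem θ) (t : Tile n) :
    interior (t.region θ) = t.point θ '' (Ioo 0 1 ×ˢ Ioo 0 1) := by
  rw [region_eq_image, ← t.coe_chart hθ, ← Homeomorph.image_interior, interior_prod_eq,
    interior_Icc]

lemma closure_halfOpen (hθ : IsDirectionSystem θ) (t : Tile n) :
    closure (t.halfOpen θ) = t.region θ := by
  rw [region_eq_image, halfOpen, ← t.coe_chart hθ, ← Homeomorph.image_closure, closure_prod_eq,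
    closure_Ico zero_ne_one, closure_Ioc zero_ne_one]

lemma point_mem_region_iff (hθ : IsDirectionSystem θ) :
    t.point θ x ∈ t.region θ ↔ x ∈ Icc (0 : ℝ) 1 ×ˢ Icc (0 : ℝ) 1 := by
  rw [region_eq_image, (t.point_injective hθ).mem_set_image]

lemma isClosed_region (hθ : IsDirectionSystem θ) (t : Tile n) : IsClosed (t.region θ) :=
  t.closure_halfOpen hθ ▸ isClosed_closure

lemma convex_region (t : Tile n) : Convex ℝ (t.region θ) := by
  rw [region_eq_image]
  rintro _ ⟨x, hx, rfl⟩ _ ⟨y, hy, rfl⟩ a b ha hb hab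
  refine ⟨a • x + b • y, ((convex_Icc 0 1).prod (convex_Icc 0 1)) hx hy ha hb hab, ?_⟩
  have hab' : (a : ℂ) + b = 1 := by exact_mod_cast hab
  simp only [point, Prod.fst_add, Prod.smul_fst, Prod.snd_add, Prod.smul_snd, smul_eq_mul,
    Complex.real_smul]
  push_cast
  linear_combination -t.top * hab'

lemma halfOpen_subset_region (t : Tile n) : t.halfOpen θ ⊆ t.region θ := by
  rw [region_eq_image]
  exact image_mono (prod_mono Ico_subset_Icc_self Ioc_subset_Icc_self)

lemma leftBoundary_subset_region (t : Tile n) : t.leftBoundary θ ⊆ t.region θ := by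
  rw [region_eq_image]
  exact image_mono (sep_subset _ _)

lemma rightBoundary_subset_region (t : Tile n) : t.rightBoundary θ ⊆ t.region θ := by
  rw [region_eq_image]
  exact image_mono (sep_subset _ _)

lemma interior_region_subset_halfOpen (hθ : IsDirectionSystem θ) (t : Tile n) :
    interior (t.region θ) ⊆ t.halfOpen θ := by
  rw [interior_region hθ]
  exact image_mono (prod_mono Ioo_subset_Ico_self Ioo_subset_Ioc_self)

lemma region_subset_union (t : Tile n) :
    t.region θ ⊆ t.halfOpen θ ∪ t.leftBoundary θ := by
  rw [region_eq_image, halfOpen, leftBoundary, ← image_union]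
  refine image_mono fun x hx => ?_
  by_cases h : x.1 = 1 ∨ x.2 = 0
  · exact Or.inr ⟨hx, h⟩
  · push Not at h
    exact Or.inl ⟨⟨hx.1.1, hx.1.2.lt_of_ne h.1⟩, hx.2.1.lt_of_ne' h.2, hx.2.2⟩

lemma exists_point_add (hθ : IsDirectionSystem θ) (t : Tile n) : ∃ α > (0 : ℝ), ∃ β > (0 : ℝ),
    ∀ (x : ℝ × ℝ) (ε : ℝ), t.point θ x + ε = t.point θ (x.1 - ε * β, x.2 + ε * α) := by
  obtain ⟨α, hα, β, hβ, e⟩ := hθ.exists_one_eq t.lo_lt_hi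
  refine ⟨α, hα, β, hβ, fun x ε => ?_⟩
  unfold point
  push_cast
  linear_combination (ε : ℂ) * e

lemma region_subset_leftOf_rightBoundary (hθ : IsDirectionSystem θ) (t : Tile n) :
    t.region θ ⊆ leftOf (t.rightBoundary θ) := by
  obtain ⟨α, hα, β, hβ, shift⟩ := t.exists_point_add hθ
  rw [region_eq_image]
  rintro _ ⟨x, hx, rfl⟩
  obtain ⟨ε, hε, h1, h2, h⟩ := exists_slide hx.1.1 (sub_nonneg.2 hx.2.2) hβ hα
  refine ⟨ε, hε, _, ⟨⟨⟨h1, ?_⟩, ?_, ?_⟩, ?_⟩, (shift x ε).symm⟩ <;> dsimp only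
  · nlinarith [hx.1.2]
  · nlinarith [hx.2.1]
  · linarith
  · exact h.imp id fun h => by linarith

lemma region_subset_rightOf_leftBoundary (hθ : IsDirectionSystem θ) (t : Tile n) :
    t.region θ ⊆ rightOf (t.leftBoundary θ) := by
  obtain ⟨α, hα, β, hβ, shift⟩ := t.exists_point_add hθ
  rw [region_eq_image]
  rintro _ ⟨x, hx, rfl⟩
  obtain ⟨ε, hε, h1, h2, h⟩ := exists_slide (sub_nonneg.2 hx.1.2) hx.2.1 hβ hα
  refine ⟨-ε, neg_nonpos.2 hε, _, ⟨⟨⟨?_, ?_⟩, ?_, ?_⟩, ?_⟩, (shift x (-ε)).symm⟩ <;> dsimp only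
  · nlinarith [hx.1.1]
  · linarith
  · linarith
  · nlinarith [hx.2.2]
  · exact h.imp (fun h => by linarith) fun h => by linarith

lemma eventually_add_mem_interior (hθ : IsDirectionSystem θ) (hz : z ∈ t.halfOpen θ) :
    ∀ᶠ ε : ℝ in 𝓝[<] 0, z + ε ∈ interior (t.region θ) := by
  obtain ⟨α, hα, β, hβ, shift⟩ := t.exists_point_add hθ
  obtain ⟨x, ⟨⟨ha0, ha1⟩, hb0, hb1⟩, rfl⟩ := hz
  filter_upwards [Ioo_mem_nhdsLT (div_neg_of_neg_of_pos (sub_neg.2 ha1) hβ),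
    Ioo_mem_nhdsLT (div_neg_of_neg_of_pos (neg_neg_of_pos hb0) hα)] with ε h1 h2
  have hεβ := (div_lt_iff₀ hβ).1 h1.1
  have hεα := (div_lt_iff₀ hα).1 h2.1
  rw [interior_region hθ, shift]
  refine ⟨_, ⟨⟨?_, ?_⟩, ?_, ?_⟩, rfl⟩ <;> dsimp only <;> nlinarith [h1.2]

lemma mem_halfOpen_of_frequently (hθ : IsDirectionSystem θ)
    (hz : ∃ᶠ ε : ℝ in 𝓝[<] 0, z + ε ∈ t.region θ) : z ∈ t.halfOpen θ := by
  obtain ⟨α, hα, β, hβ, shift⟩ := t.exists_point_add hθ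
  have hmem := (t.isClosed_region hθ).mem_of_frequently_of_tendsto hz
    (tendsto_add_ofReal_nhdsWithin z _)
  obtain ⟨ε, hε, hneg⟩ := (hz.and_eventually self_mem_nhdsWithin).exists
  obtain ⟨x, rfl⟩ := t.point_surjective hθ z
  rw [shift, point_mem_region_iff hθ] at hε
  obtain ⟨⟨ha, -⟩, -, hb⟩ := (point_mem_region_iff hθ).1 hmem
  have hεβ := mul_neg_of_neg_of_pos hneg hβ
  have hεα := mul_neg_of_neg_of_pos hneg hα
  exact ⟨x, ⟨⟨ha, by linarith [hε.1.2]⟩, by linarith [hε.2.1], hb⟩, rfl⟩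

end Tile

end Tiles

section HalfOpenTilings

variable {n : ℕ} {θ : Fin n → ℝ} {w : Equiv.Perm (Fin n)} {T : Finset (Tile n)} {z : ℂ}

/-- The tiles without their left edges partition the polygon without its leftside boundary. For
fully supported permutations this amounts to a rhombic tiling, but the notion is also adequate for
polygons that are pinched or degenerate, so that tiles can be added and removed one at a time. -/
structure IsHalfOpenTiling (θ : Fin n → ℝ) (w : Equiv.Perm (Fin n)) (T : Finset (Tile n)) :
    Prop where
  biUnion_eq : ⋃ t ∈ T, t.halfOpen θ = polygon θ w \ path θ 1
  pairwiseDisjoint : (T : Set (Tile n)).PairwiseDisjoint (Tile.halfOpen θ)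

namespace IsDirectionSystem

lemma notMem_path_one (hθ : IsDirectionSystem θ) {r : ℝ} (hr : r < 0)
    (h : z + r ∈ polygon θ w) : z ∉ path θ 1 := fun hz => by
  rw [polygon_eq_inter] at h
  exact hθ.notMem_leftOf_path hr h.1 (subset_leftOf hz)

lemma notMem_interior_polygon (hθ : IsDirectionSystem θ) (hz : z ∈ path θ w) :
    z ∉ interior (polygon θ w) := fun h => by
  obtain ⟨ε, hmem, hε⟩ := (((tendsto_add_ofReal_nhdsWithin z (Ioi 0)).eventually
    (isOpen_interior.mem_nhds h)).and self_mem_nhdsWithin).exists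
  have := interior_subset hmem
  rw [polygon_eq_inter] at this
  exact hθ.notMem_leftOf_path (neg_neg_of_pos hε) (subset_rightOf (by simpa using hz)) this.2

end IsDirectionSystem

lemma eventually_add_mem_polygon (hz : z ∈ polygon θ w \ path θ 1) :
    ∀ᶠ ε : ℝ in 𝓝[<] 0, z + ε ∈ polygon θ w := by
  rw [polygon_eq_inter] at hz ⊢
  obtain ⟨⟨⟨r, hr, hr'⟩, s, hs, hs'⟩, hz1⟩ := hz
  have hr0 : r ≠ 0 := by
    rintro rfl
    exact hz1 (by simpa using hr')
  filter_upwards [Ioo_mem_nhdsLT (hr.lt_of_ne hr0)] with ε hε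
  exact ⟨⟨r - ε, by linarith [hε.1], by simpa using hr'⟩, s - ε, by linarith [hε.2],
    by simpa using hs'⟩

lemma IsRhombicTiling.isHalfOpenTiling (hθ : IsDirectionSystem θ) (hT : IsRhombicTiling θ w T) :
    IsHalfOpenTiling θ w T where
  biUnion_eq := by
    refine (iUnion₂_subset fun t ht z hz => ?_).antisymm fun z hz => ?_
    · have region_subset : t.region θ ⊆ polygon θ w := hT.1 ▸ subset_biUnion_of_mem ht
      obtain ⟨ε, hmem, hε⟩ :=
        ((Tile.eventually_add_mem_interior hθ hz).and self_mem_nhdsWithin).exists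
      exact ⟨region_subset (t.halfOpen_subset_region hz),
        hθ.notMem_path_one hε (region_subset (interior_subset hmem))⟩
    · have covered := (eventually_add_mem_polygon hz).frequently
      simp only [← hT.1, mem_iUnion₂, exists_prop, Finset.frequently_exists] at covered
      obtain ⟨t, ht, hfreq⟩ := covered
      exact mem_biUnion ht (Tile.mem_halfOpen_of_frequently hθ hfreq)
  pairwiseDisjoint s hs t ht hst := disjoint_left.2 fun z hzs hzt => by
    obtain ⟨ε, hεs, hεt⟩ := ((Tile.eventually_add_mem_interior hθ hzs).and
      (Tile.eventually_add_mem_interior hθ hzt)).exists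
    exact disjoint_left.1 (hT.2 s hs t ht hst) hεs hεt

namespace IsHalfOpenTiling

lemma isRhombicTiling (hT : IsHalfOpenTiling θ w T) (hθ : IsDirectionSystem θ)
    (hw : FullySupported w) (hn : 2 ≤ n) : IsRhombicTiling θ w T := by
  constructor
  · rw [← hw.closure_polygon_sdiff hθ hn, ← hT.biUnion_eq, Finset.closure_biUnion]
    simp only [Tile.closure_halfOpen hθ]
  · exact fun s hs t ht hst => (hT.pairwiseDisjoint hs ht hst).mono
      (s.interior_region_subset_halfOpen hθ) (t.interior_region_subset_halfOpen hθ)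

lemma halfOpen_subset (hT : IsHalfOpenTiling θ w T) {t : Tile n} (ht : t ∈ T) :
    t.halfOpen θ ⊆ polygon θ w \ path θ 1 :=
  hT.biUnion_eq ▸ subset_biUnion_of_mem ht

lemma region_subset (hT : IsHalfOpenTiling θ w T) (hθ : IsDirectionSystem θ) {t : Tile n}
    (ht : t ∈ T) : t.region θ ⊆ polygon θ w :=
  t.closure_halfOpen hθ ▸
    closure_minimal ((hT.halfOpen_subset ht).trans sdiff_subset) (isClosed_polygon θ w)

lemma eq_of_mem_halfOpen (hT : IsHalfOpenTiling θ w T) {s t : Tile n} (hs : s ∈ T) (ht : t ∈ T)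
    (hzs : z ∈ s.halfOpen θ) (hzt : z ∈ t.halfOpen θ) : s = t :=
  hT.pairwiseDisjoint.elim_set hs ht z hzs hzt

lemma exists_mem_rightBoundary (hT : IsHalfOpenTiling θ w T) (hθ : IsDirectionSystem θ)
    (hz : z ∈ path θ w) (hz1 : z ∉ path θ 1) :
    ∃ t ∈ T, (∃ b ∈ Ioc (0 : ℝ) 1, z = t.point θ (0, b)) ∨
      ∃ a ∈ Ico (0 : ℝ) 1, z = t.point θ (a, 1) := by
  have hcov : z ∈ ⋃ t ∈ T, t.halfOpen θ := hT.biUnion_eq ▸ ⟨hθ.path_subset_polygon w hz, hz1⟩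
  obtain ⟨t, ht, ⟨a, b⟩, ⟨ha, hb⟩, rfl⟩ := mem_iUnion₂.1 hcov
  refine ⟨t, ht, ?_⟩
  rcases ha.1.eq_or_lt with rfl | ha0
  · exact Or.inl ⟨b, hb, rfl⟩
  rcases hb.2.eq_or_lt with rfl | hb1
  · exact Or.inr ⟨a, ha, rfl⟩
  refine absurd (interior_mono (hT.region_subset hθ ht) ?_) (hθ.notMem_interior_polygon hz)
  rw [Tile.interior_region hθ]
  exact mem_image_of_mem _ ⟨⟨ha0, ha.2⟩, hb.1, hb1⟩

end IsHalfOpenTiling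

end HalfOpenTilings

section Swaps

variable {n : ℕ} {k k' : Fin n} {θ : Fin n → ℝ} {w : Equiv.Perm (Fin n)}

/-- The tile enclosed by two consecutive sides of a path and by the same sides in opposite order. -/
noncomputable def swapTile (θ : Fin n → ℝ) (w : Equiv.Perm (Fin n)) (h : w k' < w k) : Tile n :=
  ⟨pathVertex θ w k, w k', w k, h⟩

lemma pathVertex_mul_swap (hk : (k : ℕ) + 1 = k') {j : ℕ} (hj : j ≠ k') :
    pathVertex θ (w * Equiv.swap k k') j = pathVertex θ w j := by
  refine Finset.sum_equiv (Equiv.swap k k') (fun i => ?_) fun i _ => rfl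
  simp only [Finset.mem_filter, Finset.mem_univ, true_and]
  rcases eq_or_ne i k with rfl | h1
  · rw [Equiv.swap_apply_left]; omega
  rcases eq_or_ne i k' with rfl | h2
  · rw [Equiv.swap_apply_right]; omega
  · rw [Equiv.swap_apply_of_ne_of_ne h1 h2]

lemma pathSide_mul_swap (hk : (k : ℕ) + 1 = k') {j : Fin n} (hj : j ≠ k) (hj' : j ≠ k') :
    pathSide θ (w * Equiv.swap k k') j = pathSide θ w j := by
  have h : (j : ℕ) ≠ k := Fin.val_ne_of_ne hj
  have h' : (j : ℕ) ≠ k' := Fin.val_ne_of_ne hj'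
  rw [pathSide, pathSide, pathVertex_mul_swap hk h', pathVertex_mul_swap hk (by omega)]

lemma rightBoundary_swapTile (hk : (k : ℕ) + 1 = k') (h : w k' < w k) :
    (swapTile θ w h).rightBoundary θ = pathSide θ w k ∪ pathSide θ w k' := by
  have hv : pathVertex θ w k' = pathVertex θ w k + dir θ (w k) := by rw [← hk, pathVertex_succ]
  ext z
  rw [mem_union, mem_pathSide_iff, mem_pathSide_iff, hv]
  constructor
  · rintro ⟨⟨a, b⟩, ⟨⟨ha, hb⟩, rfl | rfl⟩, rfl⟩
    · exact Or.inl ⟨b, hb, by simp [swapTile, Tile.point]⟩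
    · exact Or.inr ⟨a, ha, by simp [swapTile, Tile.point, add_right_comm]⟩
  · rintro (⟨s, hs, rfl⟩ | ⟨s, hs, rfl⟩)
    · exact ⟨(0, s), ⟨⟨by simp, hs⟩, Or.inl rfl⟩, by simp [swapTile, Tile.point]⟩
    · exact ⟨(s, 1), ⟨⟨hs, by simp⟩, Or.inr rfl⟩,
        by simp [swapTile, Tile.point, add_right_comm]⟩

lemma leftBoundary_swapTile (hk : (k : ℕ) + 1 = k') (h : w k' < w k) :
    (swapTile θ w h).leftBoundary θ =
      pathSide θ (w * Equiv.swap k k') k ∪ pathSide θ (w * Equiv.swap k k') k' := by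
  have hv : pathVertex θ (w * Equiv.swap k k') k' = pathVertex θ w k + dir θ (w k') := by
    rw [← hk, pathVertex_succ, pathVertex_mul_swap hk (by omega)]
    simp
  ext z
  rw [mem_union, mem_pathSide_iff, mem_pathSide_iff, hv, pathVertex_mul_swap hk (by omega)]
  simp only [Equiv.Perm.mul_apply, Equiv.swap_apply_left, Equiv.swap_apply_right]
  constructor
  · rintro ⟨⟨a, b⟩, ⟨⟨ha, hb⟩, rfl | rfl⟩, rfl⟩
    · exact Or.inr ⟨b, hb, by simp [swapTile, Tile.point]⟩
    · exact Or.inl ⟨a, ha, by simp [swapTile, Tile.point]⟩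
  · rintro (⟨s, hs, rfl⟩ | ⟨s, hs, rfl⟩)
    · exact ⟨(s, 0), ⟨⟨hs, by simp⟩, Or.inr rfl⟩, by simp [swapTile, Tile.point]⟩
    · exact ⟨(1, s), ⟨⟨by simp, hs⟩, Or.inl rfl⟩, by simp [swapTile, Tile.point]⟩

lemma rightBoundary_swapTile_subset_path (hk : (k : ℕ) + 1 = k') (h : w k' < w k) :
    (swapTile θ w h).rightBoundary θ ⊆ path θ w := by
  rw [rightBoundary_swapTile hk]
  exact union_subset (pathSide_subset_path w k) (pathSide_subset_path w k')

lemma leftBoundary_swapTile_subset_path (hk : (k : ℕ) + 1 = k') (h : w k' < w k) :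
    (swapTile θ w h).leftBoundary θ ⊆ path θ (w * Equiv.swap k k') := by
  rw [leftBoundary_swapTile hk]
  exact union_subset (pathSide_subset_path _ k) (pathSide_subset_path _ k')

lemma path_subset_union_rightBoundary (hk : (k : ℕ) + 1 = k') (h : w k' < w k) :
    path θ w ⊆ path θ (w * Equiv.swap k k') ∪ (swapTile θ w h).rightBoundary θ := by
  rw [rightBoundary_swapTile hk]
  refine iUnion_subset fun j => ?_
  rcases eq_or_ne j k with rfl | hj
  · exact fun z hz => Or.inr (Or.inl hz)
  rcases eq_or_ne j k' with rfl | hj'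
  · exact fun z hz => Or.inr (Or.inr hz)
  · exact fun z hz =>
      Or.inl (pathSide_subset_path _ j (by rwa [pathSide_mul_swap hk hj hj']))

lemma path_mul_swap_subset_union_leftBoundary (hk : (k : ℕ) + 1 = k') (h : w k' < w k) :
    path θ (w * Equiv.swap k k') ⊆ path θ w ∪ (swapTile θ w h).leftBoundary θ := by
  rw [leftBoundary_swapTile hk]
  refine iUnion_subset fun j => ?_
  rcases eq_or_ne j k with rfl | hj
  · exact fun z hz => Or.inr (Or.inl hz)
  rcases eq_or_ne j k' with rfl | hj'
  · exact fun z hz => Or.inr (Or.inr hz)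
  · exact fun z hz =>
      Or.inl (pathSide_subset_path _ j (by rwa [← pathSide_mul_swap hk hj hj']))

namespace IsDirectionSystem

lemma polygon_eq_union_region (hθ : IsDirectionSystem θ) (hk : (k : ℕ) + 1 = k')
    (h : w k' < w k) :
    polygon θ w = polygon θ (w * Equiv.swap k k') ∪ (swapTile θ w h).region θ := by
  set w' := w * Equiv.swap k k'
  set t := swapTile θ w h
  have region_subset_leftOf : t.region θ ⊆ leftOf (path θ w) :=
    (t.region_subset_leftOf_rightBoundary hθ).trans
      (leftOf_subset_leftOf ((rightBoundary_swapTile_subset_path hk h).trans subset_leftOf))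
  simp only [polygon_eq_inter]
  apply Subset.antisymm
  · rintro z ⟨hz, s, hs, hzs⟩
    rcases path_subset_union_rightBoundary hk h hzs with hzs' | hzs'
    · exact Or.inl ⟨hz, s, hs, hzs'⟩
    have hR := t.rightBoundary_subset_region hzs'
    obtain ⟨r, -, hzr⟩ := t.region_subset_rightOf_leftBoundary hθ hR
    rw [add_assoc, ← Complex.ofReal_add] at hzr
    rcases le_total 0 (s + r) with hsr | hsr
    · exact Or.inl ⟨hz, s + r, hsr, leftBoundary_swapTile_subset_path hk h hzr⟩
    · exact Or.inr
        (mem_of_add_mem_of_convex t.convex_region hsr hs (t.leftBoundary_subset_region hzr) hR)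
  · refine union_subset (inter_subset_inter_right _ (leftOf_subset_leftOf ?_))
      (subset_inter ?_ region_subset_leftOf)
    · exact (path_mul_swap_subset_union_leftBoundary hk h).trans
        (union_subset subset_leftOf (t.leftBoundary_subset_region.trans region_subset_leftOf))
    · exact (t.region_subset_rightOf_leftBoundary hθ).trans (rightOf_subset_rightOf
        ((leftBoundary_swapTile_subset_path hk h).trans (hθ.path_subset_rightOf w')))

lemma disjoint_polygon_halfOpen (hθ : IsDirectionSystem θ) (hk : (k : ℕ) + 1 = k')
    (h : w k' < w k) :
    Disjoint (polygon θ (w * Equiv.swap k k')) ((swapTile θ w h).halfOpen θ) := by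
  rw [polygon_eq_inter]
  refine disjoint_left.2 fun z hz hzt => ?_
  obtain ⟨ε, hmem, hε⟩ :=
    ((Tile.eventually_add_mem_interior hθ hzt).and self_mem_nhdsWithin).exists
  refine hθ.notMem_leftOf_path hε (rightOf_subset_rightOf ?_
    (Tile.region_subset_rightOf_leftBoundary hθ _ (interior_subset hmem))) hz.2
  exact (leftBoundary_swapTile_subset_path hk h).trans subset_rightOf

lemma polygon_sdiff_eq_union_halfOpen (hθ : IsDirectionSystem θ) (hk : (k : ℕ) + 1 = k')
    (h : w k' < w k) : polygon θ w \ path θ 1 =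
      (polygon θ (w * Equiv.swap k k') \ path θ 1) ∪ (swapTile θ w h).halfOpen θ := by
  have hdisj : Disjoint (path θ 1) ((swapTile θ w h).halfOpen θ) := by
    refine (hθ.disjoint_polygon_halfOpen hk h).mono_left ?_
    rw [polygon_eq_inter]
    exact subset_inter subset_rightOf (hθ.path_one_subset_leftOf _)
  have hunion : polygon θ w =
      polygon θ (w * Equiv.swap k k') ∪ (swapTile θ w h).halfOpen θ := by
    rw [hθ.polygon_eq_union_region hk h]
    refine Subset.antisymm (union_subset subset_union_left ?_)
      (union_subset_union_right _ (Tile.halfOpen_subset_region _))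
    exact (Tile.region_subset_union _).trans (union_subset subset_union_right
      (((leftBoundary_swapTile_subset_path hk h).trans
        (hθ.path_subset_polygon _)).trans subset_union_left))
  rw [hunion, union_sdiff_distrib, hdisj.symm.sdiff_eq_left]

end IsDirectionSystem

namespace IsHalfOpenTiling

variable {T : Finset (Tile n)}

open scoped Classical in
lemma insert_swapTile (hT : IsHalfOpenTiling θ (w * Equiv.swap k k') T)
    (hθ : IsDirectionSystem θ) (hk : (k : ℕ) + 1 = k') (h : w k' < w k) :
    IsHalfOpenTiling θ w (insert (swapTile θ w h) T) where
  biUnion_eq := by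
    rw [Finset.set_biUnion_insert, hT.biUnion_eq, hθ.polygon_sdiff_eq_union_halfOpen hk h,
      union_comm]
  pairwiseDisjoint := by
    rw [Finset.coe_insert]
    refine hT.pairwiseDisjoint.insert fun t ht _ => ?_
    exact ((hθ.disjoint_polygon_halfOpen hk h).mono_left
      ((hT.halfOpen_subset ht).trans sdiff_subset)).symm

open scoped Classical in
lemma erase_swapTile (hT : IsHalfOpenTiling θ w T) (hθ : IsDirectionSystem θ)
    (hk : (k : ℕ) + 1 = k') (h : w k' < w k) (ht : swapTile θ w h ∈ T) :
    IsHalfOpenTiling θ (w * Equiv.swap k k') (T.erase (swapTile θ w h)) where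
  biUnion_eq := by
    have hdisj := (hθ.disjoint_polygon_halfOpen hk h).mono_left
      (sdiff_subset (t := path θ 1))
    have hdiff := biUnion_sdiff_biUnion_eq (s := (T : Set (Tile n))) (t := {swapTile θ w h})
      (hT.pairwiseDisjoint.subset (union_subset Subset.rfl (singleton_subset_iff.2 ht)))
    rw [biUnion_singleton] at hdiff
    simp only [← Finset.mem_coe, Finset.coe_erase]
    rw [← hdiff, ← hdisj.sdiff_eq_left, ← union_sdiff_right (s := _ \ _),
      ← hθ.polygon_sdiff_eq_union_halfOpen hk h, ← hT.biUnion_eq]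
    simp only [Finset.mem_coe]
  pairwiseDisjoint := hT.pairwiseDisjoint.subset (Finset.erase_subset _ _)

end IsHalfOpenTiling

end Swaps

section Peeling

variable {n : ℕ} {θ : Fin n → ℝ} {w : Equiv.Perm (Fin n)} {T : Finset (Tile n)} {t : Tile n}
  {k : Fin n}

lemma IsDirectionSystem.exists_eq_add_of_frequently (hθ : IsDirectionSystem θ) {p c : ℂ}
    {i j : Fin n}
    (h : ∃ᶠ δ : ℝ in 𝓝[>] 0, ∃ b ∈ Icc (0 : ℝ) 1, c + b * dir θ j = p + δ * dir θ i) :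
    j = i ∧ ∃ b ∈ Ico (0 : ℝ) 1, p = c + b * dir θ j := by
  have hclosed : IsClosed ((fun b : ℝ => c + b * dir θ j) '' Icc 0 1) :=
    (isCompact_Icc.image (by fun_prop)).isClosed
  have htendsto : Tendsto (fun δ : ℝ => p + δ * dir θ i) (𝓝[>] 0) (𝓝 p) :=
    ((by fun_prop : Continuous fun δ : ℝ => p + δ * dir θ i).tendsto' 0 p (by simp)).mono_left
      nhdsWithin_le_nhds
  obtain ⟨b, hb, rfl⟩ := hclosed.mem_of_frequently_of_tendsto h htendsto
  obtain ⟨δ, ⟨b', hb', e⟩, hδ⟩ := (h.and_eventually self_mem_nhdsWithin).exists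
  have e' : (δ : ℂ) * dir θ i = ((b' - b : ℝ) : ℂ) * dir θ j := by
    push_cast
    linear_combination -e
  obtain rfl := hθ.eq_of_mul_dir_eq (ne_of_gt hδ) e'
  have hbδ : δ = b' - b := by exact_mod_cast mul_right_cancel₀ (hθ.dir_ne_zero i) e'
  exact ⟨rfl, b, ⟨hb.1, by linarith [hb'.2, show 0 < δ from hδ]⟩, rfl⟩

lemma IsDirectionSystem.add_mul_dir_notMem_path_one (hθ : IsDirectionSystem θ) (hk : w k ≠ k)
    {s : ℝ} (hs : s ∈ Ioo (0 : ℝ) 1) : pathVertex θ w k + s * dir θ (w k) ∉ path θ 1 := by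
  intro h
  have hs' := Ioo_subset_Icc_self hs
  rw [← pathPoint_add w k hs'] at h
  obtain ⟨σ, hσ, e⟩ := exists_pathPoint_eq h
  have key := (hθ.eq_of_pathPoint_eq (fin_add_mem_Icc k hs') hσ e.symm).2 k
  rw [ramp_add _ _ hs', ramp_add _ _ hs'] at key
  have hk' : (w k : ℕ) ≠ k := Fin.val_ne_of_ne hk
  simp only [lt_irrefl, if_false, if_true, hk'] at key
  split_ifs at key
  · exact hs.2.ne key
  · exact hs.1.ne' key

lemma eventually_notMem_path {z : ℂ} (hz : z ∉ path θ w) (v : ℂ) :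
    ∀ᶠ δ : ℝ in 𝓝[>] 0, z + δ * v ∉ path θ w := by
  have hcont : Continuous fun δ : ℝ => z + δ * v := by fun_prop
  exact ((hcont.tendsto' 0 z (by simp)).mono_left nhdsWithin_le_nhds).eventually
    ((isCompact_path w).isClosed.isOpen_compl.mem_nhds hz)

lemma IsHalfOpenTiling.exists_tile_below (hT : IsHalfOpenTiling θ w T)
    (hθ : IsDirectionSystem θ) {s : ℝ} (hs : s ∈ Ico (0 : ℝ) 1)
    (hleft : ∀ᶠ δ : ℝ in 𝓝[>] 0,
      pathVertex θ w k + s * dir θ (w k) + δ * dir θ (w k) ∉ path θ 1) :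
    ∃ t ∈ T,
      (t.hi = w k ∧ ∃ b ∈ Ico (0 : ℝ) 1,
        pathVertex θ w k + s * dir θ (w k) = t.point θ (0, b)) ∨
      (t.lo = w k ∧ ∃ a ∈ Ico (0 : ℝ) 1,
        pathVertex θ w k + s * dir θ (w k) = t.point θ (a, 1)) := by
  set p := pathVertex θ w k + s * dir θ (w k) with hp
  have covered : ∀ᶠ δ : ℝ in 𝓝[>] 0, ∃ t ∈ T,
      (∃ b ∈ Icc (0 : ℝ) 1, t.top + b * dir θ t.hi = p + δ * dir θ (w k)) ∨
      ∃ a ∈ Icc (0 : ℝ) 1, t.top + dir θ t.hi + a * dir θ t.lo = p + δ * dir θ (w k) := by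
    filter_upwards [hleft, Ioo_mem_nhdsGT (sub_pos.2 hs.2)] with δ hδ hδ'
    have hmem : p + δ * dir θ (w k) ∈ path θ w := pathSide_subset_path w k <|
      mem_pathSide_iff.2 ⟨s + δ, ⟨by linarith [hs.1, hδ'.1], by linarith [hδ'.2]⟩, by
        rw [hp]; push_cast; ring⟩
    obtain ⟨t, ht, ⟨b, hb, e⟩ | ⟨a, ha, e⟩⟩ := hT.exists_mem_rightBoundary hθ hmem hδ
    · exact ⟨t, ht, Or.inl ⟨b, Ioc_subset_Icc_self hb, by simp [e, Tile.point]⟩⟩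
    · exact ⟨t, ht, Or.inr ⟨a, Ico_subset_Icc_self ha, by simp [e, Tile.point, add_right_comm]⟩⟩
  -- There are finitely many tiles, so one of them works for arbitrarily small `δ`.
  have often := covered.frequently
  simp only [Finset.frequently_exists, frequently_or_distrib] at often
  obtain ⟨t, ht, h | h⟩ := often
  · obtain ⟨hhi, b, hb, e⟩ := hθ.exists_eq_add_of_frequently h
    exact ⟨t, ht, Or.inl ⟨hhi, b, hb, by simp [e, Tile.point]⟩⟩
  · obtain ⟨hlo, a, ha, e⟩ := hθ.exists_eq_add_of_frequently h
    exact ⟨t, ht, Or.inr ⟨hlo, a, ha, by simp [e, Tile.point, add_right_comm]⟩⟩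

/-- The upper right edge of the tile `t` and the side in position `k` of the rightside boundary
lie on the same line and overlap in more than a point. -/
def Tile.OverlapsSide (θ : Fin n → ℝ) (w : Equiv.Perm (Fin n)) (t : Tile n) (k : Fin n) : Prop :=
  t.hi = w k ∧ ∃ r ∈ Ioo (-1 : ℝ) 1, t.top = pathVertex θ w k + r * dir θ (w k)

lemma Tile.eq_swapTile (t : Tile n) {k' : Fin n} (hlo : t.lo = w k') (hhi : t.hi = w k)
    (htop : t.top = pathVertex θ w k) :
    t = swapTile θ w (hlo ▸ hhi ▸ t.lo_lt_hi : w k' < w k) := by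
  obtain ⟨top, lo, hi, h⟩ := t
  simp only [swapTile, Tile.mk.injEq]
  exact ⟨htop, hlo, hhi⟩

namespace IsHalfOpenTiling

lemma point_notMem_path_one (hT : IsHalfOpenTiling θ w T) (ht : t ∈ T) {a b : ℝ}
    (ha : a ∈ Ico (0 : ℝ) 1) (hb : b ∈ Ioc (0 : ℝ) 1) : t.point θ (a, b) ∉ path θ 1 :=
  (hT.halfOpen_subset ht (mem_image_of_mem _ ⟨ha, hb⟩)).2

lemma exists_overlapsSide (hT : IsHalfOpenTiling θ w T) (hθ : IsDirectionSystem θ)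
    (hw : w ≠ 1) : ∃ t ∈ T, ∃ k, t.OverlapsSide θ w k := by
  have moved : {i | w i ≠ i}.Nonempty := by
    by_contra h
    exact hw (Equiv.ext fun i => not_not.1 fun hi => h ⟨i, hi⟩)
  obtain ⟨k, hk, hmin⟩ := Set.exists_min_image _ id (Set.toFinite _) moved
  have fixed : ∀ i < k, w i = i := fun i hi => not_not.1 fun h => (hmin i h).not_gt hi
  have hv : pathVertex θ w k = pathVertex θ 1 k := Finset.sum_congr rfl fun i hi => by
    rw [fixed i (by simpa using hi)]; rfl
  have hleft : ∀ᶠ δ : ℝ in 𝓝[>] 0,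
      pathVertex θ w k + (0 : ℝ) * dir θ (w k) + δ * dir θ (w k) ∉ path θ 1 := by
    filter_upwards [Ioo_mem_nhdsGT one_pos] with δ hδ
    simpa using hθ.add_mul_dir_notMem_path_one hk hδ
  obtain ⟨t, ht, ⟨hhi, b, hb, e⟩ | ⟨-, a, ha, e⟩⟩ :=
    hT.exists_tile_below hθ ⟨le_rfl, one_pos⟩ hleft
  · refine ⟨t, ht, k, hhi, -b, ⟨by linarith [hb.2], by linarith [hb.1]⟩, ?_⟩
    simp only [Tile.point, hhi, Complex.ofReal_zero, zero_mul, add_zero] at e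
    simp [e]
  · refine absurd ?_ (hT.point_notMem_path_one ht ha ⟨one_pos, le_rfl⟩)
    rw [← e, hv]
    exact pathSide_subset_path 1 k (mem_pathSide_iff.2 ⟨0, by simp, by simp⟩)

/-- The overlap ends where the edge of `t` ends (`c = 1`), or where the side in position `k` is
followed by the next one. -/
lemma exists_end_of_overlap (hT : IsHalfOpenTiling θ w T) (ht : t ∈ T)
    (hk : t.OverlapsSide θ w k) :
    ∃ j : Fin n, ∃ s ∈ Ico (0 : ℝ) 1, ∃ c ∈ Ioc (0 : ℝ) 1,
      pathVertex θ w j + s * dir θ (w j) = t.point θ (0, c) ∧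
      (j = k ∧ c = 1 ∨ (k : ℕ) + 1 = j ∧ t.top = pathVertex θ w k + (1 - c) * dir θ (w k)) := by
  obtain ⟨hhi, r, hr, htop⟩ := hk
  rcases lt_or_ge r 0 with hr0 | hr0
  · refine ⟨k, 1 + r, ⟨by linarith [hr.1], by linarith⟩, 1, ⟨one_pos, le_rfl⟩, ?_,
      Or.inl ⟨rfl, rfl⟩⟩
    simp only [Tile.point, htop, hhi]
    push_cast
    ring
  have hc : 1 - r ∈ Ioc (0 : ℝ) 1 := ⟨by linarith [hr.2], by linarith⟩
  have hq : pathVertex θ w ((k : ℕ) + 1) = t.point θ (0, 1 - r) := by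
    simp only [pathVertex_succ, Tile.point, htop, hhi]
    push_cast
    ring
  have hkn : (k : ℕ) + 1 < n := by
    refine Nat.lt_of_le_of_ne k.2 fun e => hT.point_notMem_path_one ht ⟨le_rfl, one_pos⟩ hc ?_
    have := NeZero.of_pos k.pos
    rw [← hq, e, pathVertex_card, ← pathPoint_card 1]
    exact pathPoint_mem_path 1 ⟨n.cast_nonneg, le_rfl⟩
  exact ⟨⟨k + 1, hkn⟩, 0, ⟨le_rfl, one_pos⟩, 1 - r, hc, by simpa using hq,
    Or.inr ⟨rfl, by simp [htop]⟩⟩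

/-- The point where the upper right edge of `t` leaves the side in position `k` decides: the tile
just below that point is either a lower overlapping tile, or `t` itself, which then has two
consecutive sides of the rightside boundary as its right edges. -/
lemma exists_lower_or_swapTile_mem (hT : IsHalfOpenTiling θ w T) (hθ : IsDirectionSystem θ)
    (ht : t ∈ T) (hk : t.OverlapsSide θ w k) :
    (∃ s ∈ T, (∃ j, s.OverlapsSide θ w j) ∧ s.top.im < t.top.im) ∨
      ∃ k k' : Fin n, (k : ℕ) + 1 = k' ∧ ∃ h : w k' < w k, swapTile θ w h ∈ T := by
  obtain ⟨j, s, hs, c, hc, hq, hj⟩ := hT.exists_end_of_overlap ht hk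
  have hleft := eventually_notMem_path
    (hq ▸ hT.point_notMem_path_one ht ⟨le_rfl, one_pos⟩ hc) (dir θ (w j))
  have eq_of_point {t' : Tile n} (ht' : t' ∈ T) {a b : ℝ} (ha : a ∈ Ico (0 : ℝ) 1)
      (hb : b ∈ Ioc (0 : ℝ) 1) (e : pathVertex θ w j + s * dir θ (w j) = t'.point θ (a, b)) :
      t' = t ∧ a = 0 ∧ b = c := by
    obtain rfl : t' = t := hT.eq_of_mem_halfOpen ht' ht (mem_image_of_mem _ ⟨ha, hb⟩)
      ⟨(0, c), ⟨⟨le_rfl, one_pos⟩, hc⟩, hq.symm.trans e⟩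
    simpa using t'.point_injective hθ (e.symm.trans hq)
  obtain ⟨t', ht', ⟨hhi, b, hb, e⟩ | ⟨hlo, a, ha, e⟩⟩ := hT.exists_tile_below hθ hs hleft
  · rcases hb.1.eq_or_lt with rfl | hb0
    · have htop : t'.top = t.top + c * dir θ t.hi := by
        simpa [Tile.point] using e.symm.trans hq
      refine Or.inl ⟨t', ht', ⟨j, hhi, s, ⟨by linarith [hs.1], hs.2⟩, ?_⟩, ?_⟩
      · simpa [Tile.point] using e.symm
      · rw [htop, Complex.add_im, Complex.im_ofReal_mul]
        nlinarith [hc.1, hθ.dir_im_neg t.hi]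
    · obtain ⟨rfl, -, rfl⟩ := eq_of_point ht' ⟨le_rfl, one_pos⟩ ⟨hb0, hb.2.le⟩ e
      rcases hj with ⟨-, hb1⟩ | ⟨hkj, -⟩
      · exact absurd hb1 hb.2.ne
      · have := w.injective (hk.1.symm.trans hhi)
        simp [this] at hkj
  · obtain ⟨rfl, -, rfl⟩ := eq_of_point ht' ha ⟨one_pos, le_rfl⟩ e
    rcases hj with ⟨rfl, -⟩ | ⟨hkj, htop⟩
    · exact absurd (hlo.trans hk.1.symm) t'.lo_lt_hi.ne
    · refine Or.inr ⟨k, j, hkj, hlo ▸ hk.1 ▸ t'.lo_lt_hi, ?_⟩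
      rwa [← t'.eq_swapTile hlo hk.1 (by simpa using htop)]

lemma exists_swapTile_mem (hT : IsHalfOpenTiling θ w T) (hθ : IsDirectionSystem θ)
    (hw : w ≠ 1) :
    ∃ k k' : Fin n, (k : ℕ) + 1 = k' ∧ ∃ h : w k' < w k, swapTile θ w h ∈ T := by
  obtain ⟨t, ⟨ht, k, hk⟩, hmin⟩ := Set.exists_min_image {t ∈ T | ∃ k, t.OverlapsSide θ w k}
    (fun t => t.top.im) (T.finite_toSet.subset fun t ht => ht.1) (hT.exists_overlapsSide hθ hw)
  refine (hT.exists_lower_or_swapTile_mem hθ ht hk).resolve_left ?_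
  rintro ⟨s, hs, hj, hlt⟩
  exact (hmin s ⟨hs, hj⟩).not_gt hlt

end IsHalfOpenTiling

end Peeling

section Existence

variable {n : ℕ} {θ : Fin n → ℝ}

lemma exists_descent {w : Equiv.Perm (Fin n)} (hw : w ≠ 1) :
    ∃ k k' : Fin n, (k : ℕ) + 1 = k' ∧ w k' < w k := by
  rcases n with _ | m
  · exact absurd (Subsingleton.elim w 1) hw
  by_contra! h
  have hmono : StrictMono w := Fin.strictMono_iff_lt_succ.2 fun i =>
    (h i.castSucc i.succ (by simp)).lt_of_ne (w.injective.ne Fin.castSucc_lt_succ.ne)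
  exact hw (DFunLike.coe_injective
    ((hmono.range_inj strictMono_id).1 (by simp [w.surjective.range_eq])))

lemma mul_swap_lex_lt {w : Equiv.Perm (Fin n)} {k k' : Fin n} (hk : k < k') (h : w k' < w k) :
    toLex (⇑(w * Equiv.swap k k')) < toLex (⇑w) :=
  ⟨k, fun j hj => congrArg w (Equiv.swap_apply_of_ne_of_ne hj.ne (hj.trans hk).ne),
    by simpa using h⟩

lemma isHalfOpenTiling_one (hθ : IsDirectionSystem θ) : IsHalfOpenTiling θ 1 ∅ where
  biUnion_eq := by simp [hθ.polygon_one]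
  pairwiseDisjoint := by simp

open scoped Classical in
lemma exists_isHalfOpenTiling (hθ : IsDirectionSystem θ) (w : Equiv.Perm (Fin n)) :
    ∃ T, IsHalfOpenTiling θ w T := by
  induction h : toLex ⇑w using WellFoundedLT.induction generalizing w with
  | ind f ih =>
    subst h
    by_cases hw : w = 1
    · exact ⟨∅, hw ▸ isHalfOpenTiling_one hθ⟩
    obtain ⟨k, k', hk, hlt⟩ := exists_descent hw
    obtain ⟨T, hT⟩ := ih _ (mul_swap_lex_lt (Fin.lt_def.2 (by omega)) hlt) _ rfl
    exact ⟨_, hT.insert_swapTile hθ hk hlt⟩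

end Existence

section RightToLeftMaxima

variable {m : ℕ} {w : Equiv.Perm (Fin (m + 1))} {v : Fin (m + 1)}

lemma FullySupported.last_ne (hw : FullySupported w) (hm : 1 ≤ m) :
    w (Fin.last m) ≠ Fin.last m := fun h => by
  have hset : {i : Fin (m + 1) | i.val < m} = {Fin.last m}ᶜ := by
    ext i
    exact (Fin.lt_last_iff_ne_last (a := i))
  refine hw m hm m.lt_succ_self ?_
  rw [hset, image_compl_eq w.bijective, image_singleton, h]

lemma isRLMax_of_isGreatest {p : Fin (m + 1)}
    (hp : IsGreatest {j | w (Fin.last m) < w j} p) : p < Fin.last m ∧ IsRLMax w p := by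
  refine ⟨Fin.lt_last_iff_ne_last.2 ?_, fun i hi => ?_⟩
  · rintro rfl
    exact lt_irrefl (w (Fin.last m)) hp.1
  · exact (not_lt.1 fun h => (hp.2 h).not_gt hi).trans_lt hp.1

lemma isFirstRLMaxAfterLast_iff :
    IsFirstRLMaxAfterLast w v ↔ IsGreatest {j | w (Fin.last m) < w j} (w.symm v) := by
  constructor
  · intro h
    have hmem : w.symm v ∈ {j | w (Fin.last m) < w j} := h.1.2 _ h.1.1
    obtain ⟨p, hp⟩ := (toFinite _).isCompact.exists_isGreatest ⟨_, hmem⟩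
    rwa [(hp.2 hmem).antisymm (h.2 (isRLMax_of_isGreatest hp))]
  · exact fun h => ⟨isRLMax_of_isGreatest h, fun i hi => h.2 (hi.2 _ hi.1)⟩

lemma exists_isFirstRLMaxAfterLast (hw : w (Fin.last m) ≠ Fin.last m) :
    ∃ v, IsFirstRLMaxAfterLast w v := by
  have hne : {j | w (Fin.last m) < w j}.Nonempty :=
    ⟨w.symm (Fin.last m), by simpa using Fin.lt_last_iff_ne_last.2 hw⟩
  obtain ⟨p, hp⟩ := (toFinite _).isCompact.exists_isGreatest hne
  exact ⟨w p, isFirstRLMaxAfterLast_iff.2 (by simpa using hp)⟩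

lemma IsFirstRLMaxAfterLast.last_lt (h : IsFirstRLMaxAfterLast w v) : w (Fin.last m) < v := by
  simpa using (isFirstRLMaxAfterLast_iff.1 h).1

lemma le_swap_of_swap_le {n : ℕ} {k k' j p : Fin n} (hk : (k : ℕ) + 1 = k') (hp : p ≠ k')
    (h : Equiv.swap k k' j ≤ p) : j ≤ Equiv.swap k k' p := by
  rw [Equiv.swap_apply_def] at h ⊢
  simp only [Fin.ext_iff, Fin.le_def, ne_eq] at hp h ⊢
  split_ifs at h ⊢ <;> omega

lemma mul_swap_apply_last {k k' : Fin (m + 1)} (hk : (k : ℕ) + 1 = k')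
    (hlast : k' ≠ Fin.last m) : (w * Equiv.swap k k') (Fin.last m) = w (Fin.last m) := by
  have hk' : Fin.last m ≠ k := (Fin.lt_def.2 (by
    have := k'.is_le; rw [Fin.val_last]; omega)).ne'
  exact congrArg w (Equiv.swap_apply_of_ne_of_ne hk' hlast.symm)

lemma IsFirstRLMaxAfterLast.mul_swap (h : IsFirstRLMaxAfterLast w v) {k k' : Fin (m + 1)}
    (hk : (k : ℕ) + 1 = k') (hlast : k' ≠ Fin.last m) (hv : w k' ≠ v) :
    IsFirstRLMaxAfterLast (w * Equiv.swap k k') v := by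
  have hmax := (isFirstRLMaxAfterLast_iff.1 h).2
  rw [isFirstRLMaxAfterLast_iff, mul_swap_apply_last hk hlast]
  refine ⟨?_, fun j hj => le_swap_of_swap_le hk (fun e => hv (by simp [← e])) (hmax hj)⟩
  exact h.last_lt.trans_eq (Equiv.apply_symm_apply _ v).symm

lemma togetherIn321_last_iff (hw : w (Fin.last m) ≠ Fin.last m) :
    TogetherIn321 w (w (Fin.last m)) (Fin.last m) ↔
      ∃ j > w.symm (Fin.last m), w (Fin.last m) < w j := by
  constructor
  · rintro ⟨i, j, k, hij, hjk, hkj, hji, hlo, hhi⟩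
    have hi : w i = Fin.last m := by
      rcases hhi with h | h | h
      · exact h.symm
      · exact absurd (Fin.le_last (w i)) (h ▸ hji.not_ge)
      · exact absurd (Fin.le_last (w j)) (h ▸ hkj.not_ge)
    have hk : k = Fin.last m := by
      rcases hlo with h | h | h
      · exact absurd (h.trans hi) hw
      · exact absurd (Fin.le_last k) (w.injective h ▸ hjk.not_ge)
      · exact (w.injective h).symm
    exact ⟨j, by rwa [← hi, Equiv.symm_apply_apply], hk ▸ hkj⟩
  · rintro ⟨j, hj, hlt⟩
    refine ⟨w.symm (Fin.last m), j, Fin.last m, hj, Fin.lt_last_iff_ne_last.2 ?_, hlt, ?_,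
      by simp, by simp⟩
    · rintro rfl
      exact lt_irrefl _ hlt
    · rw [Equiv.apply_symm_apply, Fin.lt_last_iff_ne_last, ← Equiv.apply_symm_apply w (Fin.last m)]
      exact w.injective.ne hj.ne'

lemma not_togetherIn321_last_iff (hw : w (Fin.last m) ≠ Fin.last m) :
    ¬ TogetherIn321 w (w (Fin.last m)) (Fin.last m) ↔
      IsFirstRLMaxAfterLast w (Fin.last m) := by
  have hmem : w.symm (Fin.last m) ∈ {j | w (Fin.last m) < w j} := by
    simpa using Fin.lt_last_iff_ne_last.2 hw
  rw [isFirstRLMaxAfterLast_iff, togetherIn321_last_iff hw, IsGreatest, and_iff_right hmem]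
  simp only [not_exists, not_and]
  exact forall_congr' fun j => imp_not_comm.trans (by rw [not_lt]; rfl)

end RightToLeftMaxima

section BottomTiles

lemma eq_of_segment_eq {E : Type*} [AddCommGroup E] [Module ℝ E] (f : E →ₗ[ℝ] ℝ) {x x' y y' : E}
    (hx : f x' < f x) (hy : f y' < f y) (h : segment ℝ x x' = segment ℝ y y') : x = y := by
  have le_top {a b z : E} (hab : f b < f a) (hz : z ∈ segment ℝ a b) :
      f z ≤ f a ∧ (f z = f a → z = a) := by
    rw [segment_eq_image'] at hz
    obtain ⟨s, hs, rfl⟩ := hz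
    simp only [map_add, map_smul, map_sub, smul_eq_mul]
    refine ⟨by nlinarith [hs.1], fun e => ?_⟩
    have : s = 0 := by
      simpa [(sub_neg.2 hab).ne] using e
    simp [this]
  obtain ⟨hle, hext⟩ := le_top hx (h ▸ left_mem_segment ℝ y y')
  exact (hext (hle.antisymm (le_top hy (h ▸ left_mem_segment ℝ x x')).1)).symm

variable {n : ℕ} {θ : Fin n → ℝ} {z : ℂ} {i j : Fin n}

lemma IsDirectionSystem.segment_add_dir_eq_iff (hθ : IsDirectionSystem θ) {x : ℂ} :
    segment ℝ x (x + dir θ i) = segment ℝ (z - dir θ j) z ↔ i = j ∧ z = x + dir θ i := by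
  constructor
  · intro h
    have hi := hθ.dir_im_neg i
    have hz : z.im < (z - dir θ j).im := by
      rw [Complex.sub_im]
      linarith [hθ.dir_im_neg j]
    have top_eq : x = z - dir θ j :=
      eq_of_segment_eq Complex.imLm (by simpa using hi) hz h
    have bottom_eq : x + dir θ i = z :=
      eq_of_segment_eq (-Complex.imLm) (x' := x) (by simpa using hi) (neg_lt_neg hz)
        (by rwa [segment_symm, segment_symm _ z])
    exact ⟨hθ.dir_injective (by linear_combination bottom_eq - top_eq), bottom_eq.symm⟩
  · rintro ⟨rfl, rfl⟩
    rw [add_sub_cancel_right]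

lemma Tile.segment_mem_edges_iff (hθ : IsDirectionSystem θ) (t : Tile n) :
    segment ℝ (z - dir θ j) z ∈ t.edges θ ↔
      t.lo = j ∧ (z = t.top + dir θ t.lo ∨ z = t.top + dir θ t.lo + dir θ t.hi) ∨
      t.hi = j ∧ (z = t.top + dir θ t.hi ∨ z = t.top + dir θ t.lo + dir θ t.hi) := by
  have hswap : t.top + dir θ t.lo + dir θ t.hi = t.top + dir θ t.hi + dir θ t.lo :=
    add_right_comm _ _ _
  have h4 : segment ℝ (z - dir θ j) z =
      segment ℝ (t.top + dir θ t.hi) (t.top + dir θ t.lo + dir θ t.hi) ↔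
      t.lo = j ∧ z = t.top + dir θ t.lo + dir θ t.hi := by
    rw [hswap, eq_comm, hθ.segment_add_dir_eq_iff]
  simp only [Tile.edges, mem_insert_iff, mem_singleton_iff, h4]
  simp only [eq_comm (a := segment ℝ (z - dir θ j) z), hθ.segment_add_dir_eq_iff]
  tauto

/-- The tile with labels `a < b` whose lowest vertex is the bottom vertex of the polygon. -/
noncomputable def bottomTile (θ : Fin n → ℝ) {a b : Fin n} (h : a < b) : Tile n :=
  ⟨∑ k, dir θ k - dir θ a - dir θ b, a, b, h⟩

lemma swapTile_eq_bottomTile {w : Equiv.Perm (Fin n)} {k k' : Fin n} (hk : (k : ℕ) + 1 = k')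
    (hk' : (k' : ℕ) + 1 = n) (h : w k' < w k) : swapTile θ w h = bottomTile θ h := by
  have hbottom := pathVertex_succ (θ := θ) w k'
  rw [hk', pathVertex_card, ← hk, pathVertex_succ] at hbottom
  simp only [swapTile, bottomTile, Tile.mk.injEq, and_true]
  linear_combination -hbottom

lemma IsHalfOpenTiling.eq_of_bottomTile_mem {w : Equiv.Perm (Fin n)} {T : Finset (Tile n)}
    (hT : IsHalfOpenTiling θ w T) {a b c : Fin n} {hb : a < b} {hc : a < c}
    (hbT : bottomTile θ hb ∈ T) (hcT : bottomTile θ hc ∈ T) : b = c := by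
  have hmem {d : Fin n} (hd : a < d) : ∑ k, dir θ k - dir θ a ∈ (bottomTile θ hd).halfOpen θ :=
    ⟨(0, 1), ⟨⟨le_rfl, one_pos⟩, one_pos, le_rfl⟩, by simp [bottomTile, Tile.point]⟩
  exact congrArg Tile.hi (hT.eq_of_mem_halfOpen hbT hcT (hmem hb) (hmem hc))

variable {m : ℕ} {θ : Fin (m + 1) → ℝ} {w : Equiv.Perm (Fin (m + 1))}

lemma pathSide_last (w : Equiv.Perm (Fin (m + 1))) : pathSide θ w (Fin.last m) =
    segment ℝ (∑ k, dir θ k - dir θ (w (Fin.last m))) (∑ k, dir θ k) := by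
  have hbottom := pathVertex_succ (θ := θ) w (Fin.last m)
  rw [Fin.val_last, pathVertex_card] at hbottom
  rw [pathSide, Fin.val_last, pathVertex_card, hbottom, add_sub_cancel_right]

lemma isBottomPerimeterTile_iff_eq_bottomTile (hθ : IsDirectionSystem θ)
    (hw : w (Fin.last m) < Fin.last m) {t : Tile (m + 1)} :
    IsBottomPerimeterTile θ w t ↔ t = bottomTile θ hw := by
  rw [IsBottomPerimeterTile, leftSide, rightSide, pathSide_last, pathSide_last,
    t.segment_mem_edges_iff hθ, t.segment_mem_edges_iff hθ, Equiv.Perm.one_apply]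
  constructor
  · obtain ⟨top, lo, hi, hlt⟩ := t
    simp only [bottomTile, Tile.mk.injEq]
    have hlo : lo ≠ Fin.last m := (hlt.trans_le (Fin.le_last hi)).ne
    rintro ⟨⟨h, -⟩ | ⟨rfl, hleft⟩, ⟨rfl, hright⟩ | ⟨hhi, -⟩⟩
    · exact absurd h hlo
    · exact absurd h hlo
    · refine ⟨?_, rfl, rfl⟩
      rcases hleft with hleft | hleft
      · rcases hright with hright | hright
        · exact absurd (hθ.dir_injective (add_left_cancel (hright.symm.trans hleft))) hlo
        · rw [hright]; ring
      · rw [hleft]; ring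
    · exact absurd hhi hw.ne'
  · rintro rfl
    have hbottom : ∑ k, dir θ k = (bottomTile θ hw).top + dir θ (w (Fin.last m)) +
        dir θ (Fin.last m) := by
      rw [bottomTile, sub_right_comm, sub_add_cancel, sub_add_cancel]
    exact ⟨Or.inr ⟨rfl, Or.inr hbottom⟩, Or.inl ⟨rfl, Or.inr hbottom⟩⟩

end BottomTiles

section ForcedTiles

variable {m : ℕ} {θ : Fin (m + 1) → ℝ} {w : Equiv.Perm (Fin (m + 1))} {v : Fin (m + 1)}
  {T : Finset (Tile (m + 1))}

open scoped Classical in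
lemma IsFirstRLMaxAfterLast.exists_isHalfOpenTiling (hv : IsFirstRLMaxAfterLast w v)
    (hθ : IsDirectionSystem θ) :
    ∃ T, IsHalfOpenTiling θ w T ∧ bottomTile θ hv.last_lt ∈ T := by
  induction h : w.symm v using WellFoundedGT.induction generalizing w with
  | ind p ih =>
    obtain ⟨hlt, hmax⟩ := isFirstRLMaxAfterLast_iff.1 hv
    obtain rfl : v = w p := by simp [← h]
    rw [h] at hlt hmax
    obtain ⟨p', hp⟩ : ∃ p' : Fin (m + 1), (p : ℕ) + 1 = p' := by
      have hp : p ≠ Fin.last m := by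
        rintro rfl
        exact lt_irrefl _ hv.last_lt
      exact ⟨⟨p + 1, Nat.succ_lt_succ (Fin.lt_last_iff_ne_last.2 hp)⟩, rfl⟩
    by_cases hp' : p' = Fin.last m
    · subst hp'
      obtain ⟨T, hT⟩ := Elnitsky.exists_isHalfOpenTiling hθ (w * Equiv.swap p (Fin.last m))
      refine ⟨_, hT.insert_swapTile hθ hp hlt, ?_⟩
      rw [swapTile_eq_bottomTile hp (by simp)]
      exact Finset.mem_insert_self _ _
    · have hpp' : p < p' := Fin.lt_def.2 (by omega)
      have hlt' : w p' < w p := (not_lt.1 fun h => (hmax h).not_gt hpp').trans_lt hlt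
      obtain ⟨T, hT, hmem⟩ := ih p' hpp' (hv.mul_swap hp hp' hlt'.ne)
        ((Equiv.symm_apply_eq _).2 (by simp))
      refine ⟨_, hT.insert_swapTile hθ hp hlt', Finset.mem_insert_of_mem ?_⟩
      simpa only [mul_swap_apply_last hp hp'] using hmem

open scoped Classical in
lemma IsHalfOpenTiling.bottomTile_mem (hT : IsHalfOpenTiling θ w T) (hθ : IsDirectionSystem θ)
    (hv : IsFirstRLMaxAfterLast w (Fin.last m)) : bottomTile θ hv.last_lt ∈ T := by
  induction T using Finset.strongInduction generalizing w with
  | H T ih =>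
    have hw : w ≠ 1 := by
      rintro rfl
      exact lt_irrefl _ hv.last_lt
    obtain ⟨k, k', hk, hlt, hmem⟩ := hT.exists_swapTile_mem hθ hw
    by_cases hk' : k' = Fin.last m
    · subst hk'
      have hle : k ≤ w.symm (Fin.last m) := (isFirstRLMaxAfterLast_iff.1 hv).2 hlt
      have hlt_last : (w.symm (Fin.last m) : ℕ) < Fin.last m := hv.1.1
      have value_eq : Fin.last m = w k :=
        w.symm_apply_eq.1 (le_antisymm (Fin.le_def.2 (by omega)) hle)
      rw [swapTile_eq_bottomTile hk (by simp)] at hmem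
      convert hmem
    · have h := ih _ (Finset.erase_ssubset hmem) (hT.erase_swapTile hθ hk hlt hmem)
        (hv.mul_swap hk hk' (hlt.trans_le (Fin.le_last _)).ne)
      simpa only [mul_swap_apply_last hk hk'] using Finset.mem_of_mem_erase h

lemma exists_isForcedBottomPerimeterTile_iff (hθ : IsDirectionSystem θ) (hw : FullySupported w)
    (hm : 1 ≤ m) :
    (∃ t, IsForcedBottomPerimeterTile θ w t) ↔ IsFirstRLMaxAfterLast w (Fin.last m) := by
  have hlt : w (Fin.last m) < Fin.last m := Fin.lt_last_iff_ne_last.2 (hw.last_ne hm)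
  constructor
  · rintro ⟨t, ht⟩
    obtain ⟨v, hv⟩ := exists_isFirstRLMaxAfterLast hlt.ne
    obtain ⟨T, hT, hmem⟩ := hv.exists_isHalfOpenTiling hθ
    obtain ⟨htT, hbottom⟩ := ht T (hT.isRhombicTiling hθ hw (by omega))
    obtain rfl := (isBottomPerimeterTile_iff_eq_bottomTile hθ hlt).1 hbottom
    rwa [hT.eq_of_bottomTile_mem htT hmem]
  · exact fun hv => ⟨bottomTile θ hlt, fun T hT =>
      ⟨(hT.isHalfOpenTiling hθ).bottomTile_mem hθ hv,
        (isBottomPerimeterTile_iff_eq_bottomTile hθ hlt).2 rfl⟩⟩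

lemma IsForcedBottomPerimeterTile.labels_eq {t : Tile (m + 1)}
    (ht : IsForcedBottomPerimeterTile θ w t) (hθ : IsDirectionSystem θ) (hw : FullySupported w)
    (hm : 1 ≤ m) : t.labels = {Fin.last m, w (Fin.last m)} := by
  obtain ⟨T, hT⟩ := exists_isHalfOpenTiling hθ w
  have hbottom := (ht T (hT.isRhombicTiling hθ hw (by omega))).2
  rw [(isBottomPerimeterTile_iff_eq_bottomTile hθ
    (Fin.lt_last_iff_ne_last.2 (hw.last_ne hm))).1 hbottom, Finset.pair_comm]
  rfl

end ForcedTiles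

end Elnitsky

theorem corollary4 {m : ℕ} (hm : 1 ≤ m) (θ : Fin (m + 1) → ℝ) (hθ : Elnitsky.IsDirectionSystem θ)
    (w : Equiv.Perm (Fin (m + 1))) (hw : Elnitsky.FullySupported w) :
    ((∃ t, Elnitsky.IsForcedBottomPerimeterTile θ w t) ↔
      ¬ Elnitsky.TogetherIn321 w (w (Fin.last m)) (Fin.last m)) ∧
    ((∃ t, Elnitsky.IsForcedBottomPerimeterTile θ w t) ↔
      Elnitsky.IsFirstRLMaxAfterLast w (Fin.last m)) ∧
    (∀ t, Elnitsky.IsForcedBottomPerimeterTile θ w t →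
      t.labels = {Fin.last m, w (Fin.last m)}) := by
  have forced_iff := Elnitsky.exists_isForcedBottomPerimeterTile_iff hθ hw hm
  exact ⟨forced_iff.trans (Elnitsky.not_togetherIn321_last_iff (hw.last_ne hm)).symm, forced_iff,
    fun t ht => ht.labels_eq hθ hw hm⟩
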